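/- Let $r\ge 5$ be odd and let $W(D_r)$ be the group of signed permutations of the standard basis $e_1,\dots,e_r$ of $\mathbb R^r$ with an even number of sign changes. Take $\Pi_+=\{e_i\pm e_j : 1\le i<j\le r\}$ as positive roots and $\alpha_i=e_i-e_{i+1}$ $(1\le i\le r-1)$, $\alpha_r=e_{r-1}+e_r$ as simple roots; let $\ell$ be the length function of $W(D_r)$ with respect to the simple reflections, and put $N=r(r-1)$. Write $\rho\le\eta$ if $\eta-\rho$ is a sum of simple roots with coefficients in $\mathbb Z_{\ge 0}$, and for $S\subseteq\Pi_+$ put $\operatorname{Adj}(S)=\{\gamma\in\Pi_+ : \gamma\le\beta \text{ for some }\beta\in S\}$. For $u\in W(D_r)$ let $$\nu_0(u)=u(\Pi_+)\cap\Pi_+,\qquad \nu_k(u)=u(\operatorname{Adj}(\nu_{k-1}(u)))\cap\Pi_+\quad(k\ge 1),$$ and call $u$ rational if $\nu_k(u)=\varnothing$ for all sufficiently large $k$. Let $w_0(e_i)=-e_i$ for $1\le i\le r-1$ and $w_0(e_r)=e_r$. For a non-empty subset $I=\{i_1<\cdots<i_k\}\subseteq\{1,\dots,r-1\}$ let $p_I$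 be the cycle $i_1\mapsto i_2\mapsto\cdots\mapsto i_k\mapsto r\mapsto i_1$, fixing all other points, and define $c_I,d_I\in W(D_r)$ by $$c_I(e_j)=-e_{p_I(j)}\ (1\le j\le r-1),\qquad c_I(e_r)=e_{i_1},$$ $$d_I(e_j)=-e_{p_I(j)}\ (1\le j\le r-1,\ j\ne i_k),\qquad d_I(e_{i_k})=e_r,\qquad d_I(e_r)=-e_{i_1}.$$ Then: 1. $w_0$ is rational of length $N$, and it is the only rational element of length $N$. 2. The rational elements of length $N-1$ are exactly $c_{\{r-1\}}$ and $d_{\{r-1\}}$. 3. The rational elements of minimal length among all rational elements are exactly $c_{\{1\}}$ and $d_{\{1\}}$, and $\ell(c_{\{1\}})=\ell(d_{\{1\}})=N-(2r-3)$. -/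

import Mathlib

namespace OddTypeD

/-- The real vector space `ℝ^r`; the index `i : Fin r` stands for the basis index `i + 1` in
the customary numbering `1, …, r`. -/
abbrev V (r : ℕ) : Type := Fin r → ℝ

/-- The standard basis vector. -/
def e {r : ℕ} (i : Fin r) : V r := Pi.single i 1

/-- The signed permutation `e_j ↦ ε_j e_{σ(j)}` of `ℝ^r`, as a linear automorphism. -/
def signedPerm {r : ℕ} (σ : Equiv.Perm (Fin r)) (ε : Fin r → ℤˣ) : V r ≃ₗ[ℝ] V r where
  toFun x i := ((ε (σ.symm i) : ℤ) : ℝ) * x (σ.symm i)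
  invFun y j := ((ε j : ℤ) : ℝ) * y (σ j)
  map_add' x y := by ext i; simp [mul_add]
  map_smul' c x := by ext i; simp [mul_left_comm]
  left_inv x := by
    ext j
    rcases Int.units_eq_one_or (ε j) with h | h <;> simp [h]
  right_inv y := by
    ext i
    rcases Int.units_eq_one_or (ε (σ.symm i)) with h | h <;> simp [h]

theorem signedPerm_apply_e {r : ℕ} (σ : Equiv.Perm (Fin r)) (ε : Fin r → ℤˣ) (j : Fin r) :
    signedPerm σ ε (e j) = ((ε j : ℤ) : ℝ) • e (σ j) := by
  ext i
  by_cases h : i = σ j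
  · subst h; simp [signedPerm, e]
  · have h2 : σ.symm i ≠ j := fun h3 => h (by simp [← h3])
    simp [signedPerm, e, h, h2]

theorem signedPerm_mul {r : ℕ} (σ τ : Equiv.Perm (Fin r)) (ε δ : Fin r → ℤˣ) :
    signedPerm σ ε * signedPerm τ δ = signedPerm (σ * τ) (fun j => ε (τ j) * δ j) := by
  ext x i
  simp [signedPerm, Equiv.Perm.mul_def, mul_assoc]

theorem signedPerm_one {r : ℕ} : signedPerm (1 : Equiv.Perm (Fin r)) (fun _ => 1) = 1 := by
  ext x i
  simp [signedPerm, Equiv.Perm.one_def]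

/-- The Weyl group `W(D_r)`: signed permutations of `e_1, …, e_r` with an even number of sign
changes, i.e. with product of signs equal to `1`. -/
def weylGroup (r : ℕ) : Subgroup (V r ≃ₗ[ℝ] V r) where
  carrier := {g | ∃ (σ : Equiv.Perm (Fin r)) (ε : Fin r → ℤˣ), ∏ j, ε j = 1 ∧ g = signedPerm σ ε}
  mul_mem' := by
    rintro _ _ ⟨σ, ε, hε, rfl⟩ ⟨τ, δ, hδ, rfl⟩
    refine ⟨σ * τ, fun j => ε (τ j) * δ j, ?_, signedPerm_mul σ τ ε δ⟩
    rw [Finset.prod_mul_distrib, Equiv.prod_comp τ ε, hε, hδ, one_mul]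
  one_mem' := ⟨1, fun _ => 1, by simp, signedPerm_one.symm⟩
  inv_mem' := by
    rintro _ ⟨σ, ε, hε, rfl⟩
    refine ⟨σ⁻¹, fun j => ε (σ⁻¹ j), ?_, ?_⟩
    · rw [Equiv.prod_comp σ⁻¹ ε, hε]
    · rw [inv_eq_iff_mul_eq_one, signedPerm_mul, ← signedPerm_one]
      congr 1
      · simp
      · funext j
        simp [← sq]

/-- The positive roots `e_i - e_j` and `e_i + e_j`, `i < j`. -/
def positiveRoots (r : ℕ) : Set (V r) :=
  {x | ∃ i j : Fin r, i < j ∧ (x = e i - e j ∨ x = e i + e j)}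

/-- The simple roots `e_i - e_{i+1}` (`1 ≤ i ≤ r - 1`) and `e_{r-1} + e_r`. -/
def simpleRoots (r : ℕ) : Set (V r) :=
  {x | ∃ i j : Fin r, (i : ℕ) + 1 = j ∧
    (x = e i - e j ∨ ((j : ℕ) + 1 = r ∧ x = e i + e j))}

/-- The root order: `η - ρ` is a sum of simple roots with coefficients in `ℤ_{≥ 0}`. -/
def rootLE {r : ℕ} (ρ η : V r) : Prop := η - ρ ∈ AddSubmonoid.closure (simpleRoots r)

/-- The lower closure of `S` in the root poset. -/
def adj {r : ℕ} (S : Set (V r)) : Set (V r) :=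
  {γ | γ ∈ positiveRoots r ∧ ∃ β ∈ S, rootLE γ β}

/-- The sets `ν_k(u)`. -/
def nu {r : ℕ} (u : V r ≃ₗ[ℝ] V r) : ℕ → Set (V r)
  | 0 => u '' positiveRoots r ∩ positiveRoots r
  | k + 1 => u '' adj (nu u k) ∩ positiveRoots r

/-- The rational elements of `W(D_r)`: those `u` with `ν_k(u) = ∅` for all sufficiently
large `k`. -/
def rationalElements (r : ℕ) : Set (V r ≃ₗ[ℝ] V r) :=
  {u | u ∈ weylGroup r ∧ ∃ K : ℕ, ∀ k ≥ K, nu u k = ∅}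

/-- `s` is the orthogonal reflection in a simple root (all roots satisfy `α ⬝ᵥ α = 2`). -/
def IsSimpleReflection {r : ℕ} (s : V r ≃ₗ[ℝ] V r) : Prop :=
  ∃ α ∈ simpleRoots r, ∀ x : V r, s x = x - (x ⬝ᵥ α) • α

/-- The Coxeter length: the least number of simple reflections in a word with product `u`. -/
noncomputable def length {r : ℕ} (u : V r ≃ₗ[ℝ] V r) : ℕ :=
  sInf {n | ∃ l : List (V r ≃ₗ[ℝ] V r),
    (∀ s ∈ l, IsSimpleReflection s) ∧ l.prod = u ∧ l.length = n}

/-- The element `w_0` (for odd `r`): `e_i ↦ -e_i` for `i < r`, and `e_r ↦ e_r`. -/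
def w0 (r : ℕ) : V r ≃ₗ[ℝ] V r :=
  signedPerm 1 (fun j => if (j : ℕ) + 1 = r then 1 else -1)

/-- The cycle `p_I = (i_1 i_2 ⋯ i_k r)` for `I = {i_1 < ⋯ < i_k} ⊆ {1, …, r - 1}`, sending each
listed entry to the next one and `r` to `i_1`. -/
def cyc (r : ℕ) (I : Finset ℕ) : Equiv.Perm (Fin r) :=
  ((Finset.univ.filter fun j : Fin r => (j : ℕ) + 1 ∈ I ∨ (j : ℕ) + 1 = r).sort (· ≤ ·)).formPerm

/-- The signed permutation `c_I`, for `∅ ≠ I ⊆ {1, …, r - 1}`: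
`e_j ↦ -e_{p_I(j)}` for `j < r`, and `e_r ↦ e_{p_I(r)} = e_{i_1}`. -/
def cElt (r : ℕ) (I : Finset ℕ) : V r ≃ₗ[ℝ] V r :=
  signedPerm (cyc r I) (fun j => if (j : ℕ) + 1 = r then 1 else -1)

/-- The signed permutation `d_I`, for `∅ ≠ I ⊆ {1, …, r - 1}`: `e_j ↦ -e_{p_I(j)}` for
`j ≠ max I` (so `e_r ↦ -e_{i_1}`), and `e_j ↦ e_{p_I(j)} = e_r` for `j = max I`. -/
def dElt (r : ℕ) (I : Finset ℕ) : V r ≃ₗ[ℝ] V r :=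
  signedPerm (cyc r I)
    (fun j => if (j : ℕ) + 1 ∈ I ∧ ∀ i ∈ I, i ≤ (j : ℕ) + 1 then 1 else -1)

end OddTypeD

namespace OddTypeD

/-! ### The root cone -/

/-! Write `r = n + 1` with `n` even. The length of `u` is its number of inversions
(`length_eq_card_inversions`), so `N` minus the length counts the positive roots kept positive. The
task is to find which values this count takes on rational elements.

A positive root `γ` with `u γ` positive and `γ ≤ u γ` survives in every `ν_k`, so a rational `u`
admits none. Testing a few such roots determines the shape of `u = signedPerm σ ε`. Let `p` be the
first index that is not both fixed by `σ` and negated; it exists because `r` is odd and the number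
of signs is even. Then `σ` sends the last index to `p` (`apply_last_of_rational`). Up to conjugation
by the diagram automorphism, which preserves rationality and the count, the last sign is `+`, all
others are `-`, and `i ≤ σ i` for every `i` but the last (`exists_of_rational`).

For such `σ` the roots kept positive are the `n - p` sums `e i + e (Fin.last n)` with `p ≤ i < n`,
together with at most one difference for each fixed point of `σ` strictly between `p` and `n`
(`card_nonInversions_le`). Hence the count lies between `n - p` and `2 (n - p) - 1` when `p < n`,
and is zero when `p = n`. The values `0`, `1` and the maximum `2 n - 1 = 2 r - 3` each force `σ` to
be the transposition of `p` and `n`, with `p = n`, `n - 1`, `0` respectively.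

Conversely, these transposition elements are rational because a dominant linear functional drops by
at least `1` on every root kept positive (`mem_rationalElements_of_potential`,
`swap_mem_rationalElements`). -/

theorem e_sub_e_mem_closure {n : ℕ} {i j : Fin (n + 1)} (h : i ≤ j) :
    e i - e j ∈ AddSubmonoid.closure (simpleRoots (n + 1)) := by
  induction j using Fin.induction with
  | zero =>
    obtain rfl : i = 0 := Fin.le_zero_iff.mp h
    simp
  | succ j ih =>
    rcases h.eq_or_lt with rfl | h
    · simp
    · have h1 := ih (Fin.le_castSucc_iff.mpr h)
      have h2 : e j.castSucc - e j.succ ∈ AddSubmonoid.closure (simpleRoots (n + 1)) :=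
        AddSubmonoid.subset_closure ⟨j.castSucc, j.succ, by simp, Or.inl rfl⟩
      simpa using add_mem h1 h2

/-- For `i < j`, descend from `e i` to the penultimate basis vector and from `e j` to the last one;
the remaining sum is the branch simple root. -/
theorem e_add_e_mem_closure {n : ℕ} {i j : Fin (n + 1)} (h : i ≠ j) :
    e i + e j ∈ AddSubmonoid.closure (simpleRoots (n + 1)) := by
  wlog hij : i < j generalizing i j
  · rw [add_comm (e i)]
    exact this h.symm (lt_of_le_of_ne (not_lt.mp hij) h.symm)
  have hj := j.is_lt
  have hij' : (i : ℕ) < j := hij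
  let k : Fin (n + 1) := ⟨n - 1, by omega⟩
  have h1 : e i - e k ∈ AddSubmonoid.closure (simpleRoots (n + 1)) :=
    e_sub_e_mem_closure (show (i : ℕ) ≤ n - 1 by omega)
  have h2 := e_sub_e_mem_closure (Fin.le_last j)
  have h3 : e k + e (Fin.last n) ∈ AddSubmonoid.closure (simpleRoots (n + 1)) :=
    AddSubmonoid.subset_closure ⟨k, Fin.last n, show n - 1 + 1 = n by omega,
      Or.inr ⟨by simp, rfl⟩⟩
  convert add_mem (add_mem h1 h2) h3 using 1
  abel

/-- Not a root, but it occurs as a difference of roots in the comparisons below. The last index must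
be excluded: twice the last basis vector is the difference of the two end simple roots. -/
theorem e_add_self_mem_closure {n : ℕ} {i : Fin (n + 1)} (h : i ≠ Fin.last n) :
    e i + e i ∈ AddSubmonoid.closure (simpleRoots (n + 1)) := by
  convert add_mem (e_sub_e_mem_closure (Fin.le_last i)) (e_add_e_mem_closure h) using 1
  abel

theorem e_add_e_mem_closure' {n : ℕ} {i j : Fin (n + 1)} (h : i ≠ Fin.last n) :
    e i + e j ∈ AddSubmonoid.closure (simpleRoots (n + 1)) := by
  rcases eq_or_ne i j with rfl | hij
  · exact e_add_self_mem_closure h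
  · exact e_add_e_mem_closure hij

theorem e_sub_e_mem_positiveRoots {r : ℕ} {i j : Fin r} (h : i < j) :
    e i - e j ∈ positiveRoots r := ⟨i, j, h, Or.inl rfl⟩

theorem e_add_e_mem_positiveRoots {r : ℕ} {i j : Fin r} (h : i ≠ j) :
    e i + e j ∈ positiveRoots r := by
  rcases lt_or_gt_of_ne h with h | h
  · exact ⟨i, j, h, Or.inr rfl⟩
  · exact ⟨j, i, h, Or.inr (add_comm _ _)⟩

theorem mem_closure_of_mem_positiveRoots {n : ℕ} {γ : V (n + 1)}
    (h : γ ∈ positiveRoots (n + 1)) : γ ∈ AddSubmonoid.closure (simpleRoots (n + 1)) := by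
  obtain ⟨i, j, hij, rfl | rfl⟩ := h
  · exact e_sub_e_mem_closure hij.le
  · exact e_add_e_mem_closure hij.ne

/-! ### Cycles obstruct rationality -/

/-- Each of `γ`, `γ'` lies below the image of the other, so both re-enter the lower closure at every
step and both images persist in all `nu u k`. -/
theorem not_mem_rationalElements_of_two_cycle {r : ℕ} {u : V r ≃ₗ[ℝ] V r} {γ γ' : V r}
    (hγ : γ ∈ positiveRoots r) (hγ' : γ' ∈ positiveRoots r)
    (huγ : u γ ∈ positiveRoots r) (huγ' : u γ' ∈ positiveRoots r)
    (h : rootLE γ' (u γ)) (h' : rootLE γ (u γ')) : u ∉ rationalElements r := by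
  rintro ⟨-, K, hK⟩
  have key : ∀ k, u γ ∈ nu u k ∧ u γ' ∈ nu u k := by
    intro k
    induction k with
    | zero => exact ⟨⟨⟨γ, hγ, rfl⟩, huγ⟩, ⟨⟨γ', hγ', rfl⟩, huγ'⟩⟩
    | succ k ih =>
      exact ⟨⟨⟨γ, ⟨hγ, _, ih.2, h'⟩, rfl⟩, huγ⟩, ⟨⟨γ', ⟨hγ', _, ih.1, h⟩, rfl⟩, huγ'⟩⟩
  have := (key K).1
  rw [hK K le_rfl] at this
  exact this

theorem not_mem_rationalElements_of_loop {r : ℕ} {u : V r ≃ₗ[ℝ] V r} {γ : V r}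
    (hγ : γ ∈ positiveRoots r) (huγ : u γ ∈ positiveRoots r) (h : rootLE γ (u γ)) :
    u ∉ rationalElements r :=
  not_mem_rationalElements_of_two_cycle hγ hγ huγ huγ h h

theorem signedPerm_apply_e_of_one {r : ℕ} {σ : Equiv.Perm (Fin r)} {ε : Fin r → ℤˣ} {j : Fin r}
    (h : ε j = 1) : signedPerm σ ε (e j) = e (σ j) := by
  simp [signedPerm_apply_e, h]

theorem signedPerm_apply_e_of_neg_one {r : ℕ} {σ : Equiv.Perm (Fin r)} {ε : Fin r → ℤˣ}
    {j : Fin r} (h : ε j = -1) : signedPerm σ ε (e j) = -e (σ j) := by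
  simp [signedPerm_apply_e, h]

/-! ### The shape of rational elements -/

section Shape

variable {n : ℕ} {σ : Equiv.Perm (Fin (n + 1))} {ε : Fin (n + 1) → ℤˣ}

/-- Pigeonhole: without such a `y`, `σ` would map the interval `[p, x)` into itself, hence onto
itself, and `p` would have a second preimage there. -/
theorem exists_crossing {p x : Fin (n + 1)} (hpx : p < x) (hx : σ x = p)
    (hfix : ∀ i < p, σ i = i) : ∃ y, p ≤ y ∧ y < x ∧ (ε y = 1 ∨ x ≤ σ y) := by
  by_contra! H
  have hmap : (Finset.Ico p x).image σ ⊆ Finset.Ico p x := by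
    intro z hz
    obtain ⟨y, hy, rfl⟩ := Finset.mem_image.mp hz
    rw [Finset.mem_Ico] at hy ⊢
    refine ⟨?_, (H y hy.1 hy.2).2⟩
    by_contra! hlt
    have := σ.injective (hfix _ hlt)
    rw [this] at hlt
    exact absurd hy.1 (not_le.mpr hlt)
  have heq := Finset.eq_of_subset_of_card_le hmap
    (Finset.card_image_of_injective _ σ.injective).ge
  have hp : p ∈ (Finset.Ico p x).image σ := by
    rw [heq]
    exact Finset.mem_Ico.mpr ⟨le_rfl, hpx⟩
  obtain ⟨y, hy, hyp⟩ := Finset.mem_image.mp hp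
  have : y = x := σ.injective (hyp.trans hx.symm)
  rw [Finset.mem_Ico] at hy
  exact absurd hy.2 (by simp [this])

/-- The preimage `x` of `p` satisfies `p ≤ x`, as smaller indices are fixed. If `x` is not last,
raising `e x` to `e p` or turning it into `-e p` always yields a forbidden loop or two-cycle. -/
theorem apply_last_of_rational (hu : signedPerm σ ε ∈ rationalElements (n + 1))
    {p : Fin (n + 1)} (hfix : ∀ i < p, σ i = i) (hp : ¬ (σ p = p ∧ ε p = -1)) :
    σ (Fin.last n) = p := by
  obtain ⟨x, hx⟩ := σ.surjective p
  have hpx : p ≤ x := by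
    by_contra! h
    rw [hfix x h] at hx
    exact h.ne hx
  by_contra hlast
  have hxl : x ≠ Fin.last n := by
    rintro rfl
    exact hlast hx
  have hxlt : x < Fin.last n := Fin.lt_last_iff_ne_last.mpr hxl
  have hpl : p ≠ Fin.last n := (hpx.trans_lt hxlt).ne
  revert hu
  rcases Int.units_eq_one_or (ε x) with hεx | hεx
  · have hux : signedPerm σ ε (e x) = e p := by rw [signedPerm_apply_e_of_one hεx, hx]
    rcases Int.units_eq_one_or (ε (Fin.last n)) with hεl | hεl
    · have hul := signedPerm_apply_e_of_one (σ := σ) hεl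
      apply not_mem_rationalElements_of_loop (γ := e x + e (Fin.last n))
      · exact e_add_e_mem_positiveRoots hxl
      · rw [map_add, hux, hul]
        exact e_add_e_mem_positiveRoots (Ne.symm hlast)
      · rw [rootLE, map_add, hux, hul]
        convert add_mem (e_sub_e_mem_closure hpx)
          (e_sub_e_mem_closure (Fin.le_last (σ (Fin.last n)))) using 1
        abel
    · have hul := signedPerm_apply_e_of_neg_one (σ := σ) hεl
      by_cases hσl : σ (Fin.last n) = Fin.last n
      · rw [hσl] at hul
        apply not_mem_rationalElements_of_two_cycle (γ := e x - e (Fin.last n))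
          (γ' := e x + e (Fin.last n))
        · exact e_sub_e_mem_positiveRoots hxlt
        · exact e_add_e_mem_positiveRoots hxl
        · rw [map_sub, hux, hul, sub_neg_eq_add]
          exact e_add_e_mem_positiveRoots hpl
        · rw [map_add, hux, hul, ← sub_eq_add_neg]
          exact e_sub_e_mem_positiveRoots (hpx.trans_lt hxlt)
        · rw [rootLE, map_sub, hux, hul]
          convert e_sub_e_mem_closure hpx using 1
          abel
        · rw [rootLE, map_add, hux, hul]
          convert e_sub_e_mem_closure hpx using 1
          abel
      · apply not_mem_rationalElements_of_loop (γ := e x - e (Fin.last n))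
        · exact e_sub_e_mem_positiveRoots hxlt
        · rw [map_sub, hux, hul, sub_neg_eq_add]
          exact e_add_e_mem_positiveRoots (Ne.symm hlast)
        · rw [rootLE, map_sub, hux, hul]
          convert add_mem (e_sub_e_mem_closure hpx) (e_add_e_mem_closure hσl) using 1
          abel
  · have hpx' : p < x := by
      refine lt_of_le_of_ne hpx ?_
      rintro rfl
      exact hp ⟨hx, hεx⟩
    have hux : signedPerm σ ε (e x) = -e p := by rw [signedPerm_apply_e_of_neg_one hεx, hx]
    -- The root `e y - e x` maps to `e p + e (σ y)`, or to `e p - e (σ y)` with `x ≤ σ y`; either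
    -- image lies above it.
    obtain ⟨y, hpy, hyx, hy⟩ := exists_crossing (ε := ε) hpx' hx hfix
    have hσy : σ y ≠ p := fun h => hyx.ne (σ.injective (h.trans hx.symm))
    apply not_mem_rationalElements_of_loop (γ := e y - e x) (e_sub_e_mem_positiveRoots hyx)
    · rcases Int.units_eq_one_or (ε y) with hεy | hεy
      · rw [map_sub, hux, signedPerm_apply_e_of_one hεy, sub_neg_eq_add]
        exact e_add_e_mem_positiveRoots hσy
      · rw [map_sub, hux, signedPerm_apply_e_of_neg_one hεy, sub_neg_eq_add, neg_add_eq_sub]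
        rw [hεy] at hy
        exact e_sub_e_mem_positiveRoots (hpx'.trans_le (hy.resolve_left (by decide)))
    · rw [rootLE, map_sub, hux]
      rcases Int.units_eq_one_or (ε y) with hεy | hεy
      · rw [signedPerm_apply_e_of_one hεy]
        convert add_mem (e_sub_e_mem_closure hpy) (e_add_e_mem_closure' (j := σ y) hxl) using 1
        abel
      · rw [signedPerm_apply_e_of_neg_one hεy]
        rw [hεy] at hy
        convert add_mem (e_sub_e_mem_closure hpy)
          (e_sub_e_mem_closure (hy.resolve_left (by decide))) using 1
        abel

/-- With a positive sign at `i`, the root `e i + e (Fin.last n)` is a loop: the image of the last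
vector dominates `e i`, and the image of `e i` dominates the last vector. -/
theorem sign_eq_neg_one_of_rational (hu : signedPerm σ ε ∈ rationalElements (n + 1))
    (hl : ε (Fin.last n) = 1) {i : Fin (n + 1)} (hi : i ≠ Fin.last n)
    (hpi : σ (Fin.last n) ≤ i) : ε i = -1 := by
  refine (Int.units_eq_one_or (ε i)).resolve_left fun hεi => ?_
  have hσ : σ i ≠ σ (Fin.last n) := σ.injective.ne hi
  refine not_mem_rationalElements_of_loop (γ := e i + e (Fin.last n))
    (e_add_e_mem_positiveRoots hi) ?_ ?_ hu
  · rw [map_add, signedPerm_apply_e_of_one hεi, signedPerm_apply_e_of_one hl]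
    exact e_add_e_mem_positiveRoots hσ
  · rw [rootLE, map_add, signedPerm_apply_e_of_one hεi, signedPerm_apply_e_of_one hl]
    convert add_mem (e_sub_e_mem_closure hpi) (e_sub_e_mem_closure (Fin.le_last (σ i))) using 1
    abel

/-- At the first descent `σ i < i`, some `x` in `[σ i, i)` jumps to or past `i`. Then `e x - e i`
maps to `e (σ i) - e (σ x)`, which spans a wider interval, a loop. -/
theorem le_apply_of_rational (hu : signedPerm σ ε ∈ rationalElements (n + 1))
    (hε : ∀ i, i ≠ Fin.last n → ε i = -1) (i : Fin (n + 1)) (hi : i ≠ Fin.last n) :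
    i ≤ σ i := by
  induction i using WellFoundedLT.induction with
  | ind i ih =>
  by_contra! hlt
  -- The largest non-fixed index here moves up by induction; landing below `i` would contradict
  -- maximality, since the image of a non-fixed point is not fixed.
  let S := (Finset.Ico (σ i) i).filter fun x => σ x ≠ x
  have hS : S.Nonempty :=
    ⟨σ i, by
      simp only [S, Finset.mem_filter, Finset.mem_Ico]
      exact ⟨⟨le_rfl, hlt⟩, fun h => hlt.ne (σ.injective h)⟩⟩
  obtain ⟨x, hxS, hmax⟩ := S.exists_max_image id hS
  simp only [S, Finset.mem_filter, Finset.mem_Ico, id] at hxS hmax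
  obtain ⟨⟨hx1, hx2⟩, hx3⟩ := hxS
  have hxl : x ≠ Fin.last n := (hx2.trans_le (Fin.le_last i)).ne
  have hx4 : x < σ x := lt_of_le_of_ne (ih x hx2 hxl) (Ne.symm hx3)
  have hx5 : i ≤ σ x := by
    by_contra! h
    exact absurd (hmax (σ x) ⟨⟨hx1.trans hx4.le, h⟩, fun h => hx3 (σ.injective h)⟩)
      (not_le.mpr hx4)
  have h1 := signedPerm_apply_e_of_neg_one (σ := σ) (hε i hi)
  have h2 := signedPerm_apply_e_of_neg_one (σ := σ) (hε x hxl)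
  refine not_mem_rationalElements_of_loop (γ := e x - e i) (e_sub_e_mem_positiveRoots hx2)
    ?_ ?_ hu
  · rw [map_sub, h1, h2, sub_neg_eq_add, neg_add_eq_sub]
    exact e_sub_e_mem_positiveRoots (hlt.trans_le hx5)
  · rw [rootLE, map_sub, h1, h2]
    convert add_mem (e_sub_e_mem_closure hx1) (e_sub_e_mem_closure hx5) using 1
    abel

end Shape

/-! ### The length function counts inversions -/

/-- The height of a vector: the coefficients of a root in simple roots sum up to it. -/
noncomputable def height {r : ℕ} : V r →ₗ[ℝ] ℝ :=
  ∑ i : Fin r, ((r : ℝ) - 1 - (i : ℕ)) • LinearMap.proj i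

@[simp] theorem height_e {r : ℕ} (i : Fin r) : height (e i) = (r : ℝ) - 1 - (i : ℕ) := by
  simp [height, e, Pi.single_apply]

theorem height_e_nonneg {r : ℕ} (i : Fin r) : 0 ≤ height (e i) := by
  rw [height_e]
  have : ((i : ℕ) : ℝ) + 1 ≤ r := by exact_mod_cast i.is_lt
  linarith

theorem height_e_lt {r : ℕ} {i j : Fin r} (h : i < j) : height (e j) + 1 ≤ height (e i) := by
  rw [height_e, height_e]
  have : ((i : ℕ) : ℝ) + 1 ≤ (j : ℕ) := by exact_mod_cast h
  linarith

theorem lt_of_height_e_lt {r : ℕ} {i j : Fin r} (h : height (e j) < height (e i)) : i < j := by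
  by_contra! hji
  rcases hji.eq_or_lt with rfl | hji
  · exact h.false
  · linarith [height_e_lt hji]

theorem one_le_height {r : ℕ} {γ : V r} (h : γ ∈ positiveRoots r) : 1 ≤ height γ := by
  obtain ⟨i, j, hij, rfl | rfl⟩ := h
  · rw [map_sub]
    linarith [height_e_lt hij]
  · rw [map_add]
    linarith [height_e_lt hij, height_e_nonneg j]

theorem height_simpleRoot {r : ℕ} {α : V r} (h : α ∈ simpleRoots r) : height α = 1 := by
  obtain ⟨i, j, hij, rfl | ⟨hj, rfl⟩⟩ := h
  · rw [map_sub, height_e, height_e, ← hij]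
    push_cast
    ring
  · have hj' : ((j : ℕ) : ℝ) + 1 = r := by exact_mod_cast hj
    have hij' : ((i : ℕ) : ℝ) + 1 = (j : ℕ) := by exact_mod_cast hij
    rw [map_add, height_e, height_e]
    linarith

theorem simpleRoots_subset (r : ℕ) : simpleRoots r ⊆ positiveRoots r := by
  rintro _ ⟨i, j, hij, h⟩
  have hlt : i < j := by
    show (i : ℕ) < j
    omega
  exact ⟨i, j, hlt, h.imp id And.right⟩

theorem neg_notMem_positiveRoots {r : ℕ} {γ : V r} (h : γ ∈ positiveRoots r) :
    -γ ∉ positiveRoots r := by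
  intro h'
  have := one_le_height h'
  rw [map_neg] at this
  linarith [one_le_height h]

/-- Positive and negative roots. -/
def roots (r : ℕ) : Set (V r) := {x | x ∈ positiveRoots r ∨ -x ∈ positiveRoots r}

theorem smul_e_add_smul_e_mem_roots {r : ℕ} {i j : Fin r} (h : i ≠ j) (a b : ℤˣ) :
    ((a : ℤ) : ℝ) • e i + ((b : ℤ) : ℝ) • e j ∈ roots r := by
  wlog hij : i < j generalizing i j a b
  · rw [add_comm]
    exact this h.symm b a (lt_of_le_of_ne (not_lt.mp hij) h.symm)
  rcases Int.units_eq_one_or a with rfl | rfl <;> rcases Int.units_eq_one_or b with rfl | rfl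
  · exact Or.inl ⟨i, j, hij, Or.inr (by simp)⟩
  · exact Or.inl ⟨i, j, hij, Or.inl (by simp [sub_eq_add_neg])⟩
  · exact Or.inr ⟨i, j, hij, Or.inl (by simp [sub_eq_add_neg, add_comm])⟩
  · exact Or.inr ⟨i, j, hij, Or.inr (by simp [add_comm])⟩

theorem signedPerm_mem_roots {r : ℕ} (σ : Equiv.Perm (Fin r)) (ε : Fin r → ℤˣ) {γ : V r}
    (h : γ ∈ positiveRoots r) : signedPerm σ ε γ ∈ roots r := by
  obtain ⟨i, j, hij, rfl | rfl⟩ := h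
  · rw [map_sub, signedPerm_apply_e, signedPerm_apply_e]
    convert smul_e_add_smul_e_mem_roots (σ.injective.ne hij.ne) (ε i) (-ε j) using 1
    simp [sub_eq_add_neg]
  · rw [map_add, signedPerm_apply_e, signedPerm_apply_e]
    exact smul_e_add_smul_e_mem_roots (σ.injective.ne hij.ne) (ε i) (ε j)

theorem mem_roots_of_mem_weylGroup {r : ℕ} {u : V r ≃ₗ[ℝ] V r} (hu : u ∈ weylGroup r) {γ : V r}
    (h : γ ∈ positiveRoots r) : u γ ∈ roots r := by
  obtain ⟨σ, ε, -, rfl⟩ := hu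
  exact signedPerm_mem_roots σ ε h

theorem linearEquiv_ext_e {r : ℕ} {f g : V r ≃ₗ[ℝ] V r} (h : ∀ i, f (e i) = g (e i)) : f = g := by
  apply LinearEquiv.toLinearMap_injective
  refine LinearMap.pi_ext' fun i => LinearMap.ext_ring ?_
  exact h i

theorem e_dotProduct_e {r : ℕ} (i j : Fin r) : e i ⬝ᵥ e j = if i = j then 1 else 0 := by
  simp [e, Pi.single_apply, eq_comm]

theorem dotProduct_self_of_mem {r : ℕ} {α : V r} (h : α ∈ positiveRoots r) : α ⬝ᵥ α = 2 := by
  obtain ⟨i, j, hij, rfl | rfl⟩ := h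
  · simp [e_dotProduct_e, hij.ne, hij.ne']
    norm_num
  · simp [e_dotProduct_e, hij.ne, hij.ne']
    norm_num

/-- The norm of `β - α` is positive, and both roots have norm `2`. -/
theorem dotProduct_lt_two {r : ℕ} {α β : V r} (hα : α ∈ positiveRoots r)
    (hβ : β ∈ positiveRoots r) (h : β ≠ α) : β ⬝ᵥ α < 2 := by
  have h1 : 0 < (β - α) ⬝ᵥ (β - α) := by
    refine lt_of_le_of_ne ?_ (fun h0 => h (sub_eq_zero.mp (dotProduct_self_eq_zero.mp h0.symm)))
    exact Finset.sum_nonneg fun i _ => mul_self_nonneg _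
  rw [sub_dotProduct, dotProduct_sub, dotProduct_sub, dotProduct_self_of_mem hα,
    dotProduct_self_of_mem hβ, dotProduct_comm α β] at h1
  linarith

theorem exists_mem_weylGroup_reflection {r : ℕ} {α : V r} (hα : α ∈ simpleRoots r) :
    ∃ s ∈ weylGroup r, ∀ x : V r, s x = x - (x ⬝ᵥ α) • α := by
  obtain ⟨i, j, hij, hα⟩ := hα
  have hne : i ≠ j := by
    rintro rfl
    omega
  have key : ∀ a : ℤˣ, α = e i - ((a : ℤ) : ℝ) • e j →
      ∃ s ∈ weylGroup r, ∀ x : V r, s x = x - (x ⬝ᵥ α) • α := by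
    rintro a rfl
    have hprod : ∏ k, (if k = i ∨ k = j then a else 1) = 1 := by
      rw [Finset.prod_ite, Finset.prod_const_one, mul_one, Finset.prod_const]
      have : Finset.univ.filter (fun k => k = i ∨ k = j) = {i, j} := by
        ext k
        simp
      rw [this, Finset.card_pair hne, Int.units_sq]
    refine ⟨signedPerm (Equiv.swap i j) (fun k => if k = i ∨ k = j then a else 1),
      ⟨_, _, hprod, rfl⟩, fun x => ?_⟩
    ext k
    have ha : ((a : ℤ) : ℝ) * ((a : ℤ) : ℝ) = 1 := by
      rcases Int.units_eq_one_or a with rfl | rfl <;> simp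
    simp only [signedPerm, LinearEquiv.coe_mk, LinearMap.coe_mk, AddHom.coe_mk,
      Equiv.symm_swap, Pi.sub_apply, Pi.smul_apply, smul_eq_mul, dotProduct_sub,
      dotProduct_smul, e, dotProduct_single, mul_one]
    by_cases hki : k = i
    · subst hki
      simp [hne]
    · by_cases hkj : k = j
      · subst hkj
        simp [hne, hne.symm]
        linear_combination x k * ha
      · simp [Equiv.swap_apply_of_ne_of_ne hki hkj, hki, hkj]
  rcases hα with rfl | ⟨-, rfl⟩
  · exact key 1 (by simp)
  · exact key (-1) (by simp)

theorem mem_weylGroup_of_isSimpleReflection {r : ℕ} {s : V r ≃ₗ[ℝ] V r}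
    (hs : IsSimpleReflection s) : s ∈ weylGroup r := by
  obtain ⟨α, hα, h⟩ := hs
  obtain ⟨t, ht, h'⟩ := exists_mem_weylGroup_reflection hα
  rwa [show s = t from LinearEquiv.ext fun x => (h x).trans (h' x).symm]

section Reflection

variable {r : ℕ} {s : V r ≃ₗ[ℝ] V r} {α : V r}

theorem reflection_simpleRoot (hα : α ∈ simpleRoots r) (hs : ∀ x : V r, s x = x - (x ⬝ᵥ α) • α) :
    s α = -α := by
  rw [hs, dotProduct_self_of_mem (simpleRoots_subset r hα), two_smul]
  abel

theorem reflection_mul_self (hα : α ∈ simpleRoots r)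
    (hs : ∀ x : V r, s x = x - (x ⬝ᵥ α) • α) : s * s = 1 := by
  refine LinearEquiv.ext fun x => ?_
  rw [LinearEquiv.mul_apply, hs (s x), hs x, sub_dotProduct, smul_dotProduct,
    dotProduct_self_of_mem (simpleRoots_subset r hα), smul_eq_mul]
  simp only [LinearEquiv.coe_one, id]
  module

/-- The reflection lowers the height by `γ ⬝ᵥ α < 2`, so from a height of at least `1` it cannot
reach `-1`, the largest height of a negative root. -/
theorem reflection_mem_positiveRoots (hα : α ∈ simpleRoots r)
    (hs : ∀ x : V r, s x = x - (x ⬝ᵥ α) • α) {γ : V r} (hγ : γ ∈ positiveRoots r) (hne : γ ≠ α) :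
    s γ ∈ positiveRoots r := by
  refine (mem_roots_of_mem_weylGroup
    (mem_weylGroup_of_isSimpleReflection ⟨α, hα, hs⟩) hγ).resolve_right fun h => ?_
  have h1 := one_le_height h
  rw [hs, map_neg, map_sub, map_smul, height_simpleRoot hα, smul_eq_mul] at h1
  linarith [one_le_height hγ, dotProduct_lt_two (simpleRoots_subset r hα) hγ hne]

end Reflection

open Classical in
/-- The positive roots as a finite set. -/
noncomputable def positiveFinset (r : ℕ) : Finset (V r) :=
  (Finset.univ : Finset (Fin r)).offDiag.image
    fun q => if q.1 < q.2 then e q.1 - e q.2 else e q.1 + e q.2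

theorem mem_positiveFinset {r : ℕ} {γ : V r} : γ ∈ positiveFinset r ↔ γ ∈ positiveRoots r := by
  simp only [positiveFinset, Finset.mem_image, Finset.mem_offDiag, Finset.mem_univ, true_and,
    Prod.exists]
  constructor
  · rintro ⟨i, j, hij, rfl⟩
    split_ifs with h
    · exact e_sub_e_mem_positiveRoots h
    · exact e_add_e_mem_positiveRoots hij
  · rintro ⟨i, j, hij, rfl | rfl⟩
    · exact ⟨i, j, hij.ne, if_pos hij⟩
    · exact ⟨j, i, hij.ne', by rw [if_neg (not_lt.mpr hij.le), add_comm]⟩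

theorem e_sub_e_inj {r : ℕ} {i j k l : Fin r} (hij : i ≠ j) (h : e i - e j = e k - e l) :
    i = k ∧ j = l := by
  have h1 := congrFun h i
  have h2 := congrFun h j
  simp only [e, Pi.sub_apply, Pi.single_apply, hij, hij.symm, if_true, if_false] at h1 h2
  constructor
  · by_contra hik
    rw [if_neg hik] at h1
    split_ifs at h1 <;> norm_num at h1
  · by_contra hjl
    rw [if_neg hjl] at h2
    split_ifs at h2 <;> norm_num at h2

theorem e_add_e_inj {r : ℕ} {i j k l : Fin r} (hij : i < j) (hkl : k < l)
    (h : e i + e j = e k + e l) : i = k ∧ j = l := by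
  have h1 := congrFun h i
  have h2 := congrFun h j
  simp only [e, Pi.add_apply, Pi.single_apply, hij.ne, hij.ne', if_true, if_false] at h1 h2
  have h3 : i = k ∨ i = l := by
    by_contra! hc
    rw [if_neg hc.1, if_neg hc.2] at h1
    norm_num at h1
  have h4 : j = k ∨ j = l := by
    by_contra! hc
    rw [if_neg hc.1, if_neg hc.2] at h2
    norm_num at h2
  grind

theorem e_sub_e_ne_e_add_e {r : ℕ} {i j k l : Fin r} (hij : i ≠ j) :
    e i - e j ≠ e k + e l := by
  intro h
  have h2 := congrFun h j
  simp only [e, Pi.add_apply, Pi.sub_apply, Pi.single_apply, hij.symm, if_true, if_false] at h2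
  split_ifs at h2 <;> norm_num at h2

/-- Ordered pairs of distinct indices parametrise the positive roots injectively: increasing pairs
give differences, decreasing pairs give sums. -/
theorem card_positiveFinset (r : ℕ) : (positiveFinset r).card = r * (r - 1) := by
  rw [positiveFinset, Finset.card_image_of_injOn, Finset.offDiag_card, Finset.card_univ,
    Fintype.card_fin, Nat.mul_sub_one]
  rintro ⟨i, j⟩ hq ⟨k, l⟩ hq' h
  simp only [Finset.coe_offDiag, Set.mem_offDiag] at hq hq' h
  split_ifs at h with h1 h2 h2
  · obtain ⟨rfl, rfl⟩ := e_sub_e_inj h1.ne h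
    rfl
  · exact absurd h (e_sub_e_ne_e_add_e h1.ne)
  · exact absurd h.symm (e_sub_e_ne_e_add_e h2.ne)
  · have hji : j < i := lt_of_le_of_ne (not_lt.mp h1) (Ne.symm hq.2.2)
    have hlk : l < k := lt_of_le_of_ne (not_lt.mp h2) (Ne.symm hq'.2.2)
    rw [add_comm, add_comm (e k)] at h
    obtain ⟨rfl, rfl⟩ := e_add_e_inj hji hlk h
    rfl

open Classical in
/-- The positive roots sent to negative roots by `u`. -/
noncomputable def inversions {r : ℕ} (u : V r ≃ₗ[ℝ] V r) : Finset (V r) :=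
  (positiveFinset r).filter fun γ => u γ ∉ positiveRoots r

open Classical in
/-- The positive roots sent to positive roots by `u`. -/
noncomputable def nonInversions {r : ℕ} (u : V r ≃ₗ[ℝ] V r) : Finset (V r) :=
  (positiveFinset r).filter fun γ => u γ ∈ positiveRoots r

open Classical in
theorem mem_inversions {r : ℕ} {u : V r ≃ₗ[ℝ] V r} {γ : V r} :
    γ ∈ inversions u ↔ γ ∈ positiveRoots r ∧ u γ ∉ positiveRoots r := by
  rw [inversions, Finset.mem_filter, mem_positiveFinset]

open Classical in
theorem mem_nonInversions {r : ℕ} {u : V r ≃ₗ[ℝ] V r} {γ : V r} :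
    γ ∈ nonInversions u ↔ γ ∈ positiveRoots r ∧ u γ ∈ positiveRoots r := by
  rw [nonInversions, Finset.mem_filter, mem_positiveFinset]

open Classical in
theorem card_nonInversions_add_card_inversions {r : ℕ} (u : V r ≃ₗ[ℝ] V r) :
    (nonInversions u).card + (inversions u).card = r * (r - 1) := by
  rw [← card_positiveFinset]
  exact Finset.card_filter_add_card_filter_not _

theorem inversions_one {r : ℕ} : inversions (1 : V r ≃ₗ[ℝ] V r) = ∅ := by
  ext γ
  simp [mem_inversions]

open Classical in
theorem card_inversions_mul_le {r : ℕ} {u s : V r ≃ₗ[ℝ] V r} (hs : IsSimpleReflection s) :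
    (inversions (u * s)).card ≤ (inversions u).card + 1 := by
  obtain ⟨α, hα, h⟩ := hs
  have hss := reflection_mul_self hα h
  have hsub : inversions (u * s) ⊆ insert α ((inversions u).image s) := by
    intro γ hγ
    rw [mem_inversions] at hγ
    rw [Finset.mem_insert, Finset.mem_image]
    refine or_iff_not_imp_left.mpr fun hne => ⟨s γ, ?_, ?_⟩
    · exact mem_inversions.mpr ⟨reflection_mem_positiveRoots hα h hγ.1 hne, hγ.2⟩
    · exact LinearEquiv.congr_fun hss γ
  calc (inversions (u * s)).card ≤ _ := Finset.card_le_card hsub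
    _ ≤ _ := Finset.card_insert_le _ _
    _ ≤ _ := Nat.add_le_add_right Finset.card_image_le 1

open Classical in
-- The reflection carries the inversions of `u * s` injectively into those of `u`, and misses `α`.
theorem card_inversions_mul_lt {r : ℕ} {u s : V r ≃ₗ[ℝ] V r} {α : V r} (hu : u ∈ weylGroup r)
    (hα : α ∈ simpleRoots r) (hs : ∀ x : V r, s x = x - (x ⬝ᵥ α) • α) (h : α ∈ inversions u) :
    (inversions (u * s)).card < (inversions u).card := by
  have hss := reflection_mul_self hα hs
  rw [← Finset.card_image_of_injective (inversions (u * s)) s.injective]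
  apply Finset.card_lt_card
  have hinv := mem_inversions.mp h
  have hαn : α ∉ inversions (u * s) := by
    intro h'
    apply (mem_inversions.mp h').2
    rw [LinearEquiv.mul_apply, reflection_simpleRoot hα hs, map_neg]
    exact (mem_roots_of_mem_weylGroup hu hinv.1).resolve_left hinv.2
  refine Finset.ssubset_iff_of_subset ?_ |>.mpr ⟨α, h, ?_⟩
  · intro β hβ
    obtain ⟨γ, hγ, rfl⟩ := Finset.mem_image.mp hβ
    have hne : γ ≠ α := fun hc => hαn (hc ▸ hγ)
    rw [mem_inversions] at hγ
    exact mem_inversions.mpr ⟨reflection_mem_positiveRoots hα hs hγ.1 hne, hγ.2⟩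
  · intro hc
    obtain ⟨γ, hγ, hγα⟩ := Finset.mem_image.mp hc
    have h1 : γ = -α := by
      rw [← reflection_simpleRoot hα hs, ← hγα]
      exact (LinearEquiv.congr_fun hss γ).symm
    rw [h1] at hγ
    exact neg_notMem_positiveRoots hinv.1 (mem_inversions.mp hγ).1

/-- If every simple root stays positive, then `height ∘ u` is nonnegative on the cone they generate,
so no positive root can become negative. -/
theorem exists_simpleRoot_mem_inversions {n : ℕ} {u : V (n + 1) ≃ₗ[ℝ] V (n + 1)}
    (hu : u ∈ weylGroup (n + 1)) (h : (inversions u).Nonempty) :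
    ∃ α ∈ simpleRoots (n + 1), α ∈ inversions u := by
  by_contra! H
  obtain ⟨γ, hγ⟩ := h
  obtain ⟨hγ1, hγ2⟩ := mem_inversions.mp hγ
  have hcone := mem_closure_of_mem_positiveRoots hγ1
  have hnn : 0 ≤ height (u γ) := by
    clear hγ hγ1 hγ2
    induction hcone using AddSubmonoid.closure_induction with
    | mem α hα =>
      have h1 : u α ∈ positiveRoots (n + 1) := by
        by_contra hc
        exact H α hα (mem_inversions.mpr ⟨simpleRoots_subset _ hα, hc⟩)
      linarith [one_le_height h1]
    | zero => simp
    | add x y _ _ hx hy =>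
      rw [map_add, map_add]
      exact add_nonneg hx hy
  have := one_le_height ((mem_roots_of_mem_weylGroup hu hγ1).resolve_left hγ2)
  rw [map_neg] at this
  linarith

theorem eq_one_of_inversions_eq_empty {n : ℕ} {u : V (n + 1) ≃ₗ[ℝ] V (n + 1)}
    (hu : u ∈ weylGroup (n + 1)) (h : inversions u = ∅) : u = 1 := by
  obtain ⟨σ, ε, hε, rfl⟩ := hu
  have hpos : ∀ γ ∈ positiveRoots (n + 1), 1 ≤ height (signedPerm σ ε γ) := by
    intro γ hγ
    apply one_le_height
    by_contra hc
    have := mem_inversions.mpr ⟨hγ, hc⟩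
    rw [h] at this
    exact absurd this (Finset.notMem_empty _)
  -- With a negative sign at `i`, the images of `e i - e j` and `e i + e j` would have heights with
  -- nonpositive sum. The last sign then follows from the product condition.
  have hlt : ∀ i j, i < j → ε i = 1 := by
    intro i j hij
    refine (Int.units_eq_one_or _).resolve_right fun hc => ?_
    have h1 := hpos _ (e_sub_e_mem_positiveRoots hij)
    have h2 := hpos _ (e_add_e_mem_positiveRoots hij.ne)
    rw [map_sub, map_sub, signedPerm_apply_e_of_neg_one hc, map_neg] at h1
    rw [map_add, map_add, signedPerm_apply_e_of_neg_one hc, map_neg] at h2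
    linarith [height_e_nonneg (σ i)]
  have hone : ∀ i, ε i = 1 := by
    have hi : ∀ i : Fin n, ε i.castSucc = 1 := fun i => hlt _ _ (Fin.castSucc_lt_last i)
    refine Fin.lastCases ?_ hi
    rw [Fin.prod_univ_castSucc] at hε
    simpa [hi] using hε
  have hmono : StrictMono σ := by
    intro i j hij
    have h1 := hpos _ (e_sub_e_mem_positiveRoots hij)
    rw [map_sub, map_sub, signedPerm_apply_e_of_one (hone i),
      signedPerm_apply_e_of_one (hone j)] at h1
    exact lt_of_height_e_lt (by linarith)
  have hσ : ∀ i, σ i = i := by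
    intro i
    have := Subsingleton.elim (hmono.orderIsoOfSurjective σ σ.surjective) (OrderIso.refl _)
    exact congrArg (fun f : Fin (n + 1) ≃o Fin (n + 1) => f i) this
  refine linearEquiv_ext_e fun i => ?_
  rw [signedPerm_apply_e_of_one (hone i), hσ]
  rfl

theorem card_inversions_list_prod_le {r : ℕ} (l : List (V r ≃ₗ[ℝ] V r))
    (h : ∀ s ∈ l, IsSimpleReflection s) : (inversions l.prod).card ≤ l.length := by
  induction l using List.reverseRecOn with
  | nil => simp [inversions_one]
  | append_singleton l s ih =>
    rw [List.prod_append, List.prod_singleton, List.length_append, List.length_singleton]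
    refine (card_inversions_mul_le (h s (by simp))).trans ?_
    exact Nat.add_le_add_right (ih fun t ht => h t (by simp [ht])) 1

theorem exists_word {n : ℕ} (u : V (n + 1) ≃ₗ[ℝ] V (n + 1)) (hu : u ∈ weylGroup (n + 1)) :
    ∃ l : List (V (n + 1) ≃ₗ[ℝ] V (n + 1)), (∀ s ∈ l, IsSimpleReflection s) ∧ l.prod = u ∧
      l.length ≤ (inversions u).card := by
  induction hm : (inversions u).card using Nat.strong_induction_on generalizing u with
  | _ m ih =>
  subst hm
  rcases (inversions u).eq_empty_or_nonempty with h | h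
  · exact ⟨[], by simp, by simp [eq_one_of_inversions_eq_empty hu h], by simp⟩
  · obtain ⟨α, hα, hαu⟩ := exists_simpleRoot_mem_inversions hu h
    obtain ⟨s, hsW, hs⟩ := exists_mem_weylGroup_reflection hα
    have hlt := card_inversions_mul_lt hu hα hs hαu
    obtain ⟨l, hl, hprod, hlen⟩ := ih _ hlt (u * s) (mul_mem hu hsW) rfl
    refine ⟨l ++ [s], ?_, ?_, ?_⟩
    · intro t ht
      rcases List.mem_append.mp ht with ht | ht
      · exact hl t ht
      · rw [List.mem_singleton] at ht
        exact ht ▸ ⟨α, hα, hs⟩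
    · rw [List.prod_append, hprod, List.prod_singleton, mul_assoc, reflection_mul_self hα hs,
        mul_one]
    · rw [List.length_append, List.length_singleton]
      omega

theorem length_eq_card_inversions {n : ℕ} {u : V (n + 1) ≃ₗ[ℝ] V (n + 1)}
    (hu : u ∈ weylGroup (n + 1)) : length u = (inversions u).card := by
  obtain ⟨l, hl, hprod, hlen⟩ := exists_word u hu
  apply le_antisymm
  · refine le_trans ?_ hlen
    exact Nat.sInf_le ⟨l, hl, hprod, rfl⟩
  · refine le_csInf ⟨_, l, hl, hprod, rfl⟩ ?_
    rintro _ ⟨l', hl', rfl, rfl⟩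
    exact card_inversions_list_prod_le l' hl'

theorem length_add_card_nonInversions {n : ℕ} {u : V (n + 1) ≃ₗ[ℝ] V (n + 1)}
    (hu : u ∈ weylGroup (n + 1)) : length u + (nonInversions u).card = (n + 1) * n := by
  rw [length_eq_card_inversions hu, add_comm, card_nonInversions_add_card_inversions]
  rfl

/-! ### The diagram automorphism -/

section DiagramAutomorphism

variable {n : ℕ}

/-- The sign pattern of the diagram automorphism. -/
def diagramSign (n : ℕ) (j : Fin (n + 1)) : ℤˣ := if j = Fin.last n then -1 else 1

/-- The diagram automorphism of type `D`, changing the sign of the last basis vector. -/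
def diagramAut (n : ℕ) : V (n + 1) ≃ₗ[ℝ] V (n + 1) := signedPerm 1 (diagramSign n)

theorem diagramSign_last : diagramSign n (Fin.last n) = -1 := if_pos rfl

theorem diagramSign_of_ne {j : Fin (n + 1)} (h : j ≠ Fin.last n) : diagramSign n j = 1 := if_neg h

theorem diagramAut_e_last : diagramAut n (e (Fin.last n)) = -e (Fin.last n) :=
  signedPerm_apply_e_of_neg_one diagramSign_last

theorem diagramAut_e_of_ne {j : Fin (n + 1)} (h : j ≠ Fin.last n) : diagramAut n (e j) = e j :=
  signedPerm_apply_e_of_one (diagramSign_of_ne h)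

theorem diagramSign_mul_self (j : Fin (n + 1)) : diagramSign n j * diagramSign n j = 1 := by
  rw [← sq, Int.units_sq]

theorem diagramAut_mul_self : diagramAut n * diagramAut n = 1 := by
  rw [diagramAut, signedPerm_mul, ← signedPerm_one]
  congr 1
  funext j
  exact diagramSign_mul_self j

@[simp] theorem diagramAut_diagramAut (x : V (n + 1)) : diagramAut n (diagramAut n x) = x :=
  LinearEquiv.congr_fun diagramAut_mul_self x

theorem diagramAut_mem_positiveRoots {γ : V (n + 1)} (h : γ ∈ positiveRoots (n + 1)) :
    diagramAut n γ ∈ positiveRoots (n + 1) := by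
  obtain ⟨i, j, hij, hγ⟩ := h
  have hi : i ≠ Fin.last n := (hij.trans_le (Fin.le_last j)).ne
  refine ⟨i, j, hij, ?_⟩
  by_cases hj : j = Fin.last n
  · subst hj
    rcases hγ with rfl | rfl
    · exact Or.inr (by rw [map_sub, diagramAut_e_of_ne hi, diagramAut_e_last, sub_neg_eq_add])
    · exact Or.inl (by rw [map_add, diagramAut_e_of_ne hi, diagramAut_e_last, ← sub_eq_add_neg])
  · rcases hγ with rfl | rfl
    · exact Or.inl (by rw [map_sub, diagramAut_e_of_ne hi, diagramAut_e_of_ne hj])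
    · exact Or.inr (by rw [map_add, diagramAut_e_of_ne hi, diagramAut_e_of_ne hj])

/-- The two simple roots at the fork are exchanged and the others are fixed; hence the root order,
and with it `adj` and `nu`, is respected. -/
theorem diagramAut_mem_simpleRoots {γ : V (n + 1)} (h : γ ∈ simpleRoots (n + 1)) :
    diagramAut n γ ∈ simpleRoots (n + 1) := by
  obtain ⟨i, j, hij, hγ⟩ := h
  have hi : i ≠ Fin.last n := by
    rintro rfl
    have := j.is_lt
    rw [Fin.val_last] at hij
    omega
  refine ⟨i, j, hij, ?_⟩
  by_cases hj : j = Fin.last n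
  · subst hj
    rcases hγ with rfl | ⟨-, rfl⟩
    · exact Or.inr ⟨by simp, by
        rw [map_sub, diagramAut_e_of_ne hi, diagramAut_e_last, sub_neg_eq_add]⟩
    · exact Or.inl (by rw [map_add, diagramAut_e_of_ne hi, diagramAut_e_last, ← sub_eq_add_neg])
  · rcases hγ with rfl | ⟨hj', rfl⟩
    · exact Or.inl (by rw [map_sub, diagramAut_e_of_ne hi, diagramAut_e_of_ne hj])
    · exact absurd (Fin.ext (by simpa using hj')) hj

theorem diagramAut_mem_positiveRoots_iff {γ : V (n + 1)} :
    diagramAut n γ ∈ positiveRoots (n + 1) ↔ γ ∈ positiveRoots (n + 1) :=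
  ⟨fun h => by simpa using diagramAut_mem_positiveRoots h, diagramAut_mem_positiveRoots⟩

theorem rootLE_diagramAut {ρ η : V (n + 1)} (h : rootLE ρ η) :
    rootLE (diagramAut n ρ) (diagramAut n η) := by
  rw [rootLE, ← map_sub]
  rw [rootLE] at h
  generalize η - ρ = z at h ⊢
  induction h using AddSubmonoid.closure_induction with
  | mem α hα => exact AddSubmonoid.subset_closure (diagramAut_mem_simpleRoots hα)
  | zero => simp
  | add x y _ _ hx hy =>
    rw [map_add]
    exact add_mem hx hy

/-- Conjugation by the diagram automorphism. -/
def diagramConj (u : V (n + 1) ≃ₗ[ℝ] V (n + 1)) : V (n + 1) ≃ₗ[ℝ] V (n + 1) :=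
  diagramAut n * u * diagramAut n

theorem diagramConj_apply (u : V (n + 1) ≃ₗ[ℝ] V (n + 1)) (x : V (n + 1)) :
    diagramConj u x = diagramAut n (u (diagramAut n x)) := rfl

theorem diagramConj_diagramConj (u : V (n + 1) ≃ₗ[ℝ] V (n + 1)) :
    diagramConj (diagramConj u) = u :=
  LinearEquiv.ext fun x => by simp [diagramConj_apply]

theorem diagramConj_signedPerm (σ : Equiv.Perm (Fin (n + 1))) (ε : Fin (n + 1) → ℤˣ) :
    diagramConj (signedPerm σ ε) =
      signedPerm σ fun j => diagramSign n (σ j) * ε j * diagramSign n j := by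
  rw [diagramConj, diagramAut, signedPerm_mul, signedPerm_mul, one_mul, mul_one]
  rfl

theorem diagramConj_mem_weylGroup {u : V (n + 1) ≃ₗ[ℝ] V (n + 1)} (hu : u ∈ weylGroup (n + 1)) :
    diagramConj u ∈ weylGroup (n + 1) := by
  obtain ⟨σ, ε, hε, rfl⟩ := hu
  refine ⟨σ, _, ?_, diagramConj_signedPerm σ ε⟩
  rw [Finset.prod_mul_distrib, Finset.prod_mul_distrib, hε, Equiv.prod_comp σ (diagramSign n),
    mul_one, ← sq, Int.units_sq]

theorem mem_image_diagramConj {u : V (n + 1) ≃ₗ[ℝ] V (n + 1)} {S T : Set (V (n + 1))}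
    (h : ∀ x ∈ T, diagramAut n x ∈ S) {y : V (n + 1)}
    (hy : y ∈ diagramConj u '' T ∩ positiveRoots (n + 1)) :
    diagramAut n y ∈ u '' S ∩ positiveRoots (n + 1) := by
  obtain ⟨⟨x, hx, rfl⟩, hy⟩ := hy
  exact ⟨⟨diagramAut n x, h x hx, by rw [diagramConj_apply, diagramAut_diagramAut]⟩,
    diagramAut_mem_positiveRoots hy⟩

theorem diagramAut_mem_nu {u : V (n + 1) ≃ₗ[ℝ] V (n + 1)} {k : ℕ} {y : V (n + 1)}
    (hy : y ∈ nu (diagramConj u) k) : diagramAut n y ∈ nu u k := by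
  induction k generalizing y with
  | zero => exact mem_image_diagramConj (fun x hx => diagramAut_mem_positiveRoots hx) hy
  | succ k ih =>
    refine mem_image_diagramConj (fun x hx => ?_) hy
    obtain ⟨hx, β, hβ, hle⟩ := hx
    exact ⟨diagramAut_mem_positiveRoots hx, _, ih hβ, rootLE_diagramAut hle⟩

theorem diagramConj_mem_rationalElements {u : V (n + 1) ≃ₗ[ℝ] V (n + 1)}
    (hu : u ∈ rationalElements (n + 1)) : diagramConj u ∈ rationalElements (n + 1) := by
  obtain ⟨hu, K, hK⟩ := hu
  refine ⟨diagramConj_mem_weylGroup hu, K, fun k hk => ?_⟩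
  refine Set.eq_empty_of_forall_notMem fun y hy => ?_
  have := diagramAut_mem_nu hy
  rw [hK k hk] at this
  exact this

open Classical in
theorem card_nonInversions_diagramConj (u : V (n + 1) ≃ₗ[ℝ] V (n + 1)) :
    (nonInversions (diagramConj u)).card = (nonInversions u).card := by
  rw [← Finset.card_image_of_injective (nonInversions u) (diagramAut n).injective]
  congr 1
  ext γ
  simp only [Finset.mem_image, mem_nonInversions]
  constructor
  · rintro ⟨h1, h2⟩
    exact ⟨diagramAut n γ, ⟨diagramAut_mem_positiveRoots h1,
      diagramAut_mem_positiveRoots_iff.mp h2⟩, diagramAut_diagramAut γ⟩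
  · rintro ⟨β, ⟨h1, h2⟩, rfl⟩
    refine ⟨diagramAut_mem_positiveRoots h1, ?_⟩
    rw [diagramConj_apply, diagramAut_diagramAut]
    exact diagramAut_mem_positiveRoots h2

end DiagramAutomorphism

/-! ### Classification up to the diagram automorphism -/

section Classification

variable {n : ℕ} {σ : Equiv.Perm (Fin (n + 1))} {ε : Fin (n + 1) → ℤˣ}

/-- The sign pattern negating all basis vectors but the last. -/
def initSign (n : ℕ) (j : Fin (n + 1)) : ℤˣ := if j = Fin.last n then 1 else -1

theorem initSign_last : initSign n (Fin.last n) = 1 := if_pos rfl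

theorem initSign_of_ne {j : Fin (n + 1)} (h : j ≠ Fin.last n) : initSign n j = -1 := if_neg h

theorem signs_of_rational (hu : signedPerm σ ε ∈ rationalElements (n + 1))
    (hl : ε (Fin.last n) = 1) (hlt : ∀ i < σ (Fin.last n), ε i = -1) :
    ε = initSign n ∧ ∀ i, i ≠ Fin.last n → i ≤ σ i := by
  have hε : ∀ i, i ≠ Fin.last n → ε i = -1 := by
    intro i hi
    rcases lt_or_ge i (σ (Fin.last n)) with h | h
    · exact hlt i h
    · exact sign_eq_neg_one_of_rational hu hl hi h
  refine ⟨?_, le_apply_of_rational hu hε⟩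
  funext i
  by_cases hi : i = Fin.last n
  · rw [hi, hl, initSign_last]
  · rw [hε i hi, initSign_of_ne hi]

theorem exists_of_rational (hn : Even n) {u : V (n + 1) ≃ₗ[ℝ] V (n + 1)}
    (hu : u ∈ rationalElements (n + 1)) :
    ∃ σ : Equiv.Perm (Fin (n + 1)), (∀ i, i ≠ Fin.last n → i ≤ σ i) ∧
      (u = signedPerm σ (initSign n) ∨ u = diagramConj (signedPerm σ (initSign n))) := by
  obtain ⟨σ, ε, hε, rfl⟩ := hu.1
  refine ⟨σ, ?_⟩
  -- Oddness of the rank enters here: `-1` has an odd number of sign changes, so it is not in the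
  -- Weyl group.
  have hex : ∃ p, ¬ (σ p = p ∧ ε p = -1) := by
    by_contra! H
    have : ∏ j, ε j = (-1) ^ (n + 1) := by
      rw [Finset.prod_congr rfl fun j _ => (H j).2]
      simp
    rw [this, hn.add_one.neg_one_pow] at hε
    exact absurd hε (by decide)
  obtain ⟨p, hp, hmin⟩ := WellFounded.has_min (wellFounded_lt (α := Fin (n + 1)))
    {p | ¬ (σ p = p ∧ ε p = -1)} hex
  have hfix : ∀ i < p, σ i = i ∧ ε i = -1 := fun i hi => by
    by_contra hc
    exact hmin i hc hi
  have hlast := apply_last_of_rational hu (fun i hi => (hfix i hi).1) hp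
  rcases Int.units_eq_one_or (ε (Fin.last n)) with hl | hl
  · obtain ⟨h1, h2⟩ := signs_of_rational hu hl fun i hi => (hfix i (hlast ▸ hi)).2
    exact ⟨h2, Or.inl (by rw [h1])⟩
  · have hpl : p ≠ Fin.last n := by
      rintro rfl
      exact hp ⟨hlast, hl⟩
    -- Since the last index maps to `p`, which is not last, conjugation turns the last sign into `+`
    -- and leaves the signs below `p` alone.
    have hu' := diagramConj_mem_rationalElements hu
    rw [diagramConj_signedPerm] at hu'
    obtain ⟨h1, h2⟩ := signs_of_rational hu' (by
        rw [hl, hlast, diagramSign_of_ne hpl, diagramSign_last]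
        rfl) fun i hi => by
      rw [hlast] at hi
      have hil : i ≠ Fin.last n := (hi.trans_le (Fin.le_last p)).ne
      rw [(hfix i hi).1, (hfix i hi).2, diagramSign_of_ne hil]
      rfl
    refine ⟨h2, Or.inr ?_⟩
    rw [← h1, ← diagramConj_signedPerm, diagramConj_diagramConj]

theorem signedPerm_initSign_mem_weylGroup (hn : Even n) (σ : Equiv.Perm (Fin (n + 1))) :
    signedPerm σ (initSign n) ∈ weylGroup (n + 1) := by
  refine ⟨σ, _, ?_, rfl⟩
  rw [Fin.prod_univ_castSucc, initSign_last,
    Finset.prod_congr rfl fun j _ => initSign_of_ne (Fin.castSucc_lt_last j).ne]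
  simp [hn.neg_one_pow]

end Classification

/-! ### A criterion for rationality -/

/-- Passing to smaller roots does not increase `w`, and each application of `u` costs at least `1`.
So `w ≤ M - k` on `nu u k`, while `w` is nonnegative on positive roots. -/
theorem mem_rationalElements_of_potential {n : ℕ} {u : V (n + 1) ≃ₗ[ℝ] V (n + 1)}
    (hu : u ∈ weylGroup (n + 1)) (w : V (n + 1) →ₗ[ℝ] ℝ)
    (hw : ∀ α ∈ simpleRoots (n + 1), 0 ≤ w α) {M : ℝ} (hM : ∀ γ ∈ positiveRoots (n + 1), w γ ≤ M)
    (hdec : ∀ γ ∈ nonInversions u, w (u γ) + 1 ≤ w γ) : u ∈ rationalElements (n + 1) := by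
  have hcone : ∀ x ∈ AddSubmonoid.closure (simpleRoots (n + 1)), 0 ≤ w x := by
    intro x hx
    induction hx using AddSubmonoid.closure_induction with
    | mem α hα => exact hw α hα
    | zero => simp
    | add x y _ _ hx hy =>
      rw [map_add]
      exact add_nonneg hx hy
  have key : ∀ k, ∀ β ∈ nu u k, w β + k ≤ M := by
    intro k
    induction k with
    | zero =>
      rintro β ⟨-, hβ⟩
      simpa using hM β hβ
    | succ k ih =>
      rintro _ ⟨⟨γ, ⟨hγ, β, hβ, hle⟩, rfl⟩, huγ⟩
      have h1 := hdec γ (mem_nonInversions.mpr ⟨hγ, huγ⟩)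
      have h2 := ih β hβ
      have h3 := hcone _ hle
      rw [map_sub] at h3
      push_cast
      linarith
  obtain ⟨K, hK⟩ := exists_nat_gt M
  refine ⟨hu, K, fun k hk => Set.eq_empty_of_forall_notMem fun β hβ => ?_⟩
  have h1 := key k β hβ
  have h2 : β ∈ positiveRoots (n + 1) := by
    cases k <;> exact hβ.2
  have h3 := hcone β (mem_closure_of_mem_positiveRoots h2)
  have h4 : (K : ℝ) ≤ k := by exact_mod_cast hk
  linarith

/-! ### Counting non-inversions -/

section Count

variable {n : ℕ} {σ : Equiv.Perm (Fin (n + 1))}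

theorem initSign_apply_e {i : Fin (n + 1)} (hi : i ≠ Fin.last n) :
    signedPerm σ (initSign n) (e i) = -e (σ i) :=
  signedPerm_apply_e_of_neg_one (initSign_of_ne hi)

theorem initSign_apply_e_last :
    signedPerm σ (initSign n) (e (Fin.last n)) = e (σ (Fin.last n)) :=
  signedPerm_apply_e_of_one initSign_last

theorem apply_eq_of_lt (hσ : ∀ i, i ≠ Fin.last n → i ≤ σ i) (i : Fin (n + 1))
    (hi : i < σ (Fin.last n)) : σ i = i := by
  induction i using WellFoundedLT.induction with
  | ind i ih =>
  obtain ⟨x, hx⟩ := σ.surjective i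
  have hxl : x ≠ Fin.last n := by
    rintro rfl
    exact hi.ne hx.symm
  rcases (hσ x hxl).eq_or_lt with h | h
  · rw [hx] at h
    rw [← h, hx, h]
  · rw [hx] at h
    have := ih x h (h.trans hi)
    exact absurd (this.symm.trans hx) h.ne

/-- Every value up to `k`, except possibly the image of the last index, has its preimage up to `k`.
This leaves room for only one index up to `k` whose value exceeds `k`. -/
theorem crossing_unique (hσ : ∀ i, i ≠ Fin.last n → i ≤ σ i) {a b k : Fin (n + 1)}
    (hak : a ≤ k) (hbk : b ≤ k) (ha : k < σ a) (hb : k < σ b) : a = b := by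
  by_contra hab
  have hmaps : ∀ y ∈ (Finset.Iic k).erase (σ (Fin.last n)),
      σ.symm y ∈ ((Finset.Iic k).erase a).erase b := by
    intro y hy
    rw [Finset.mem_erase, Finset.mem_Iic] at hy
    have hl : σ.symm y ≠ Fin.last n := by
      intro h
      exact hy.1 (by rw [← h, Equiv.apply_symm_apply])
    have hle := hσ _ hl
    rw [Equiv.apply_symm_apply] at hle
    rw [Finset.mem_erase, Finset.mem_erase, Finset.mem_Iic]
    refine ⟨?_, ?_, hle.trans hy.2⟩
    · rintro rfl
      rw [Equiv.apply_symm_apply] at hb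
      exact absurd hy.2 (not_le.mpr hb)
    · rintro rfl
      rw [Equiv.apply_symm_apply] at ha
      exact absurd hy.2 (not_le.mpr ha)
  have hcard := Finset.card_le_card_of_injOn _ hmaps σ.symm.injective.injOn
  rw [Finset.card_erase_of_mem (a := b) (Finset.mem_erase.mpr ⟨Ne.symm hab,
      Finset.mem_Iic.mpr hbk⟩), Finset.card_erase_of_mem (Finset.mem_Iic.mpr hak)] at hcard
  have h1 := Finset.pred_card_le_card_erase (s := Finset.Iic k) (a := σ (Fin.last n))
  have h2 : 1 < (Finset.Iic k).card :=
    Finset.one_lt_card.mpr ⟨a, Finset.mem_Iic.mpr hak, b, Finset.mem_Iic.mpr hbk, hab⟩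
  omega

/-- The other two kinds of positive root have image minus a sum of two basis vectors, which has
nonpositive height. -/
theorem exists_of_mem_nonInversions (hσ : ∀ i, i ≠ Fin.last n → i ≤ σ i) {γ : V (n + 1)}
    (h : γ ∈ nonInversions (signedPerm σ (initSign n))) :
    (∃ i, σ (Fin.last n) ≤ i ∧ i < Fin.last n ∧ γ = e i + e (Fin.last n)) ∨
    (∃ i j, i < j ∧ j < Fin.last n ∧ σ j < σ i ∧ γ = e i - e j) := by
  obtain ⟨⟨i, j, hij, hγ⟩, hpos⟩ := mem_nonInversions.mp h
  have hh := one_le_height hpos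
  have hi : i < Fin.last n := hij.trans_le (Fin.le_last j)
  by_cases hj : j = Fin.last n
  · subst hj
    rcases hγ with rfl | rfl
    · rw [map_sub, map_sub, initSign_apply_e hi.ne, initSign_apply_e_last, map_neg] at hh
      linarith [height_e_nonneg (σ i), height_e_nonneg (σ (Fin.last n))]
    · rw [map_add, map_add, initSign_apply_e hi.ne, initSign_apply_e_last, map_neg] at hh
      have hlt : σ (Fin.last n) < σ i := lt_of_height_e_lt (by linarith)
      refine Or.inl ⟨i, ?_, hi, rfl⟩
      by_contra! hc
      rw [apply_eq_of_lt hσ i hc] at hlt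
      exact hlt.asymm hc
  · rcases hγ with rfl | rfl
    · rw [map_sub, map_sub, initSign_apply_e hi.ne, initSign_apply_e hj, map_neg, map_neg] at hh
      exact Or.inr ⟨i, j, hij, Fin.lt_last_iff_ne_last.mpr hj,
        lt_of_height_e_lt (by linarith), rfl⟩
    · rw [map_add, map_add, initSign_apply_e hi.ne, initSign_apply_e hj, map_neg, map_neg] at hh
      linarith [height_e_nonneg (σ i), height_e_nonneg (σ j)]

theorem e_add_e_last_mem_nonInversions (hσ : ∀ i, i ≠ Fin.last n → i ≤ σ i) {i : Fin (n + 1)}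
    (h1 : σ (Fin.last n) ≤ i) (h2 : i < Fin.last n) :
    e i + e (Fin.last n) ∈ nonInversions (signedPerm σ (initSign n)) := by
  refine mem_nonInversions.mpr ⟨e_add_e_mem_positiveRoots h2.ne, ?_⟩
  rw [map_add, initSign_apply_e h2.ne, initSign_apply_e_last, neg_add_eq_sub]
  exact e_sub_e_mem_positiveRoots
    (lt_of_le_of_ne (h1.trans (hσ i h2.ne)) (σ.injective.ne h2.ne'))

/-- The fixed points of `σ` strictly between the image of the last index and the last index. -/
def innerFixed (σ : Equiv.Perm (Fin (n + 1))) : Finset (Fin (n + 1)) :=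
  (Finset.Ioo (σ (Fin.last n)) (Fin.last n)).filter fun j => σ j = j

/-- If `j` moved up, both `i` and `j` would cross level `j`. If `j` were at most the image of the
last index, `i` would be fixed and could not overtake `σ j`. -/
theorem mem_innerFixed_of_lt (hσ : ∀ i, i ≠ Fin.last n → i ≤ σ i) {i j : Fin (n + 1)}
    (hij : i < j) (hj : j < Fin.last n) (h : σ j < σ i) : j ∈ innerFixed σ := by
  have hjj : j ≤ σ j := hσ j hj.ne
  have hfix : σ j = j := by
    by_contra hc
    have hlt : j < σ j := lt_of_le_of_ne hjj (Ne.symm hc)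
    exact hij.ne (crossing_unique hσ hij.le le_rfl (hlt.trans h) hlt)
  rw [innerFixed, Finset.mem_filter, Finset.mem_Ioo]
  refine ⟨⟨?_, hj⟩, hfix⟩
  by_contra! hc
  rw [apply_eq_of_lt hσ i (hij.trans_le hc)] at h
  exact absurd (h.trans hij) (not_lt.mpr hjj)

open Classical in
theorem card_nonInversions_le (hσ : ∀ i, i ≠ Fin.last n → i ≤ σ i) :
    (nonInversions (signedPerm σ (initSign n))).card ≤
      (n - (σ (Fin.last n) : ℕ)) + (innerFixed σ).card := by
  -- The index overtaking `j` is unique by `crossing_unique`, so each `j` accounts for at most one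
  -- difference. The default `j` only adds the zero vector to an upper bound.
  let f : Fin (n + 1) → Fin (n + 1) := fun j =>
    if h : ∃ i, i < j ∧ σ j < σ i then h.choose else j
  have hsub : nonInversions (signedPerm σ (initSign n)) ⊆
      (Finset.Ico (σ (Fin.last n)) (Fin.last n)).image (fun i => e i + e (Fin.last n)) ∪
      (innerFixed σ).image fun j => e (f j) - e j := by
    intro γ hγ
    rw [Finset.mem_union, Finset.mem_image, Finset.mem_image]
    rcases exists_of_mem_nonInversions hσ hγ with ⟨i, h1, h2, rfl⟩ | ⟨i, j, hij, hj, h, rfl⟩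
    · exact Or.inl ⟨i, Finset.mem_Ico.mpr ⟨h1, h2⟩, rfl⟩
    · refine Or.inr ⟨j, mem_innerFixed_of_lt hσ hij hj h, ?_⟩
      have hex : ∃ i, i < j ∧ σ j < σ i := ⟨i, hij, h⟩
      have hf : f j = hex.choose := dif_pos hex
      have hspec := hex.choose_spec
      have hjj := hσ j hj.ne
      have : f j = i := by
        rw [hf]
        exact crossing_unique hσ hspec.1.le hij.le (hjj.trans_lt hspec.2) (hjj.trans_lt h)
      rw [this]
  refine (Finset.card_le_card hsub).trans ((Finset.card_union_le _ _).trans ?_)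
  refine Nat.add_le_add (Finset.card_image_le.trans ?_) Finset.card_image_le
  rw [Fin.card_Ico, Fin.val_last]

theorem card_innerFixed_le : (innerFixed σ).card ≤ n - (σ (Fin.last n) : ℕ) - 1 := by
  refine (Finset.card_filter_le _ _).trans ?_
  rw [Fin.card_Ioo, Fin.val_last]

theorem e_add_e_last_injective : Function.Injective
    fun i : Fin (n + 1) => e i + e (Fin.last n) := by
  intro i j h
  have h1 := congrFun (add_right_cancel h) i
  by_contra hij
  simp [e, hij] at h1

open Classical in
theorem le_card_nonInversions (hσ : ∀ i, i ≠ Fin.last n → i ≤ σ i) :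
    n - (σ (Fin.last n) : ℕ) ≤ (nonInversions (signedPerm σ (initSign n))).card := by
  have hsub : (Finset.Ico (σ (Fin.last n)) (Fin.last n)).image
      (fun i => e i + e (Fin.last n)) ⊆ nonInversions (signedPerm σ (initSign n)) := by
    intro γ hγ
    obtain ⟨i, hi, rfl⟩ := Finset.mem_image.mp hγ
    rw [Finset.mem_Ico] at hi
    exact e_add_e_last_mem_nonInversions hσ hi.1 hi.2
  have := Finset.card_le_card hsub
  rwa [Finset.card_image_of_injective _ e_add_e_last_injective, Fin.card_Ico, Fin.val_last] at this

theorem eq_swap_of_fixed (hσ : ∀ i, i ≠ Fin.last n → i ≤ σ i)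
    (h : ∀ j, σ (Fin.last n) < j → j < Fin.last n → σ j = j) :
    σ = Equiv.swap (σ (Fin.last n)) (Fin.last n) := by
  have hfix : ∀ j, j ≠ σ (Fin.last n) → j ≠ Fin.last n → σ j = j := by
    intro j h1 h2
    rcases lt_or_gt_of_ne h1 with h1 | h1
    · exact apply_eq_of_lt hσ j h1
    · exact h j h1 (Fin.lt_last_iff_ne_last.mpr h2)
  ext j : 1
  by_cases h2 : j = Fin.last n
  · rw [h2, Equiv.swap_apply_right]
  by_cases h1 : j = σ (Fin.last n)
  · rw [h1, Equiv.swap_apply_left]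
    by_contra hc
    have h3 : σ (Fin.last n) ≠ Fin.last n := h1 ▸ h2
    have h4 := hfix _ (fun hh => h3 (σ.injective hh)) hc
    exact h3 (σ.injective (σ.injective h4))
  · rw [Equiv.swap_apply_of_ne_of_ne h1 h2, hfix j h1 h2]

theorem le_swap_apply (p i : Fin (n + 1)) (hi : i ≠ Fin.last n) :
    i ≤ Equiv.swap p (Fin.last n) i := by
  by_cases h : i = p
  · rw [h, Equiv.swap_apply_left]
    exact Fin.le_last p
  · rw [Equiv.swap_apply_of_ne_of_ne h hi]

theorem innerFixed_swap (p : Fin (n + 1)) :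
    innerFixed (Equiv.swap p (Fin.last n)) = Finset.Ioo p (Fin.last n) := by
  rw [innerFixed, Equiv.swap_apply_right]
  refine Finset.filter_true_of_mem fun j hj => ?_
  rw [Finset.mem_Ioo] at hj
  exact Equiv.swap_apply_of_ne_of_ne hj.1.ne' hj.2.ne

theorem e_sub_e_injective (p : Fin (n + 1)) : Function.Injective
    fun j : Fin (n + 1) => e p - e j := by
  intro i j h
  have h1 := congrFun (sub_right_injective h) i
  by_contra hij
  simp [e, hij] at h1

open Classical in
theorem card_nonInversions_swap (p : Fin (n + 1)) :
    (nonInversions (signedPerm (Equiv.swap p (Fin.last n)) (initSign n))).card =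
      (n - (p : ℕ)) + (n - (p : ℕ) - 1) := by
  apply le_antisymm
  · have := card_nonInversions_le (le_swap_apply p)
    rwa [Equiv.swap_apply_right, innerFixed_swap, Fin.card_Ioo, Fin.val_last] at this
  · have hdisj : Disjoint
        ((Finset.Ico p (Fin.last n)).image (fun i => e i + e (Fin.last n)))
        ((Finset.Ioo p (Fin.last n)).image fun j => e p - e j) := by
      rw [Finset.disjoint_left]
      intro γ h1 h2
      obtain ⟨i, -, rfl⟩ := Finset.mem_image.mp h1
      obtain ⟨j, hj, h⟩ := Finset.mem_image.mp h2
      exact e_sub_e_ne_e_add_e (Finset.mem_Ioo.mp hj).1.ne h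
    have hsub : ((Finset.Ico p (Fin.last n)).image (fun i => e i + e (Fin.last n))) ∪
        ((Finset.Ioo p (Fin.last n)).image fun j => e p - e j) ⊆
        nonInversions (signedPerm (Equiv.swap p (Fin.last n)) (initSign n)) := by
      intro γ hγ
      rcases Finset.mem_union.mp hγ with h | h
      · obtain ⟨i, hi, rfl⟩ := Finset.mem_image.mp h
        rw [Finset.mem_Ico] at hi
        refine e_add_e_last_mem_nonInversions (le_swap_apply p) ?_ hi.2
        rw [Equiv.swap_apply_right]
        exact hi.1
      · obtain ⟨j, hj, rfl⟩ := Finset.mem_image.mp h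
        rw [Finset.mem_Ioo] at hj
        refine mem_nonInversions.mpr ⟨e_sub_e_mem_positiveRoots hj.1, ?_⟩
        rw [map_sub, initSign_apply_e (hj.1.trans hj.2).ne, initSign_apply_e hj.2.ne,
          Equiv.swap_apply_left, Equiv.swap_apply_of_ne_of_ne hj.1.ne' hj.2.ne, sub_neg_eq_add,
          neg_add_eq_sub]
        exact e_sub_e_mem_positiveRoots hj.2
    have := Finset.card_le_card hsub
    rwa [Finset.card_union_of_disjoint hdisj,
      Finset.card_image_of_injective _ e_add_e_last_injective,
      Finset.card_image_of_injective _ (e_sub_e_injective p), Fin.card_Ico, Fin.card_Ioo,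
      Fin.val_last] at this

end Count

/-! ### Rationality of the transposition elements -/

/-- A dominant weight that strictly decreases on the non-inversions of the element attached to
the transposition of `p` and the last index. -/
noncomputable def weight {n : ℕ} (p : Fin (n + 1)) : V (n + 1) →ₗ[ℝ] ℝ :=
  ∑ i, (if i ≤ p then 4 else if i = Fin.last n then 1 else 2 : ℝ) • LinearMap.proj i

@[simp] theorem weight_e {n : ℕ} (p i : Fin (n + 1)) :
    weight p (e i) = if i ≤ p then 4 else if i = Fin.last n then 1 else 2 := by
  simp only [weight, e, LinearMap.sum_apply, LinearMap.smul_apply, LinearMap.proj_apply,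
    Pi.single_apply, smul_eq_mul, mul_ite, mul_one, mul_zero, Finset.sum_ite_eq',
    Finset.mem_univ, if_true]

theorem weight_e_antitone {n : ℕ} (p : Fin (n + 1)) {i j : Fin (n + 1)} (h : i ≤ j) :
    weight p (e j) ≤ weight p (e i) := by
  rw [weight_e, weight_e]
  have h1 : j ≤ p → i ≤ p := h.trans
  have h2 : i = Fin.last n → j = Fin.last n := fun hi => le_antisymm (Fin.le_last j) (hi ▸ h)
  grind

theorem weight_e_nonneg {n : ℕ} (p i : Fin (n + 1)) : 0 ≤ weight p (e i) := by
  rw [weight_e]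
  split_ifs <;> norm_num

theorem weight_e_le {n : ℕ} (p i : Fin (n + 1)) : weight p (e i) ≤ 4 := by
  rw [weight_e]
  split_ifs <;> norm_num

theorem swap_mem_rationalElements {n : ℕ} (hn : Even n) (p : Fin (n + 1)) :
    signedPerm (Equiv.swap p (Fin.last n)) (initSign n) ∈ rationalElements (n + 1) := by
  refine mem_rationalElements_of_potential (signedPerm_initSign_mem_weylGroup hn _) (weight p)
    ?_ (M := 8) ?_ ?_
  · intro α hα
    obtain ⟨i, j, hij, rfl | rfl⟩ := simpleRoots_subset _ hα
    · rw [map_sub, sub_nonneg]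
      exact weight_e_antitone p hij.le
    · rw [map_add]
      exact add_nonneg (weight_e_nonneg p i) (weight_e_nonneg p j)
  · rintro γ ⟨i, j, hij, rfl | rfl⟩
    · rw [map_sub]
      linarith [weight_e_le p i, weight_e_nonneg p j]
    · rw [map_add]
      linarith [weight_e_le p i, weight_e_le p j]
  -- The weights are `4` up to `p`, `2` between and `1` at the end. The drops are `5` to `3` for `e
  -- p + e (Fin.last n)`, `3` to `2` for the other sums, and `2` to `1` for the differences `e p - e
  -- j`.
  · intro γ hγ
    rcases exists_of_mem_nonInversions (le_swap_apply p) hγ with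
      ⟨i, h1, h2, rfl⟩ | ⟨i, j, hij, hj, h, rfl⟩
    · rw [Equiv.swap_apply_right] at h1
      have hp : ¬ Fin.last n ≤ p := not_le.mpr (h1.trans_lt h2)
      rw [map_add, map_add, map_add, initSign_apply_e h2.ne, initSign_apply_e_last,
        Equiv.swap_apply_right, map_neg]
      rcases h1.eq_or_lt with rfl | h1
      · rw [Equiv.swap_apply_left]
        simp only [weight_e, le_refl, if_true, hp, if_false]
        norm_num
      · rw [Equiv.swap_apply_of_ne_of_ne h1.ne' h2.ne]
        simp only [weight_e, le_refl, if_true, hp, if_false, not_le.mpr h1, h2.ne]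
        norm_num
    · have hjj := le_swap_apply p j hj.ne
      have hip : i = p := by
        by_contra hc
        rw [Equiv.swap_apply_of_ne_of_ne hc (hij.trans hj).ne] at h
        exact absurd (h.trans hij) (not_lt.mpr hjj)
      subst hip
      have hp : ¬ Fin.last n ≤ i := not_le.mpr (hij.trans hj)
      rw [map_sub, map_sub, map_sub, initSign_apply_e (hij.trans hj).ne, initSign_apply_e hj.ne,
        Equiv.swap_apply_left, Equiv.swap_apply_of_ne_of_ne hij.ne' hj.ne, map_neg, map_neg]
      simp only [weight_e, le_refl, if_true, hp, if_false, not_le.mpr hij, hj.ne]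
      norm_num

/-! ### Lengths of rational elements -/

section Lengths

variable {n : ℕ}

/-- The degenerate transposition lets `w0` share the rationality and counting results of the family.
-/
theorem w0_eq : w0 (n + 1) = signedPerm (Equiv.swap (Fin.last n) (Fin.last n)) (initSign n) := by
  rw [w0, Equiv.swap_self]
  congr 1
  funext j
  simp [initSign, Fin.ext_iff]

theorem diagramConj_w0 : diagramConj (w0 (n + 1)) = w0 (n + 1) := by
  rw [w0_eq, diagramConj_signedPerm, Equiv.swap_self]
  congr 1
  funext j
  rw [Equiv.refl_apply, mul_right_comm, diagramSign_mul_self, one_mul]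

theorem cyc_singleton {p : Fin (n + 1)} (hp : p ≠ Fin.last n) :
    cyc (n + 1) {(p : ℕ) + 1} = Equiv.swap p (Fin.last n) := by
  have h : (Finset.univ.filter fun j : Fin (n + 1) =>
      (j : ℕ) + 1 ∈ ({(p : ℕ) + 1} : Finset ℕ) ∨ (j : ℕ) + 1 = n + 1) =
      insert p {Fin.last n} := by
    ext j
    simp [Fin.ext_iff]
  rw [cyc, h, Finset.sort_insert (r := (· ≤ ·)) (by simpa using Fin.le_last p) (by simpa using hp),
    Finset.sort_singleton, List.formPerm_pair]

theorem cElt_singleton {p : Fin (n + 1)} (hp : p ≠ Fin.last n) :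
    cElt (n + 1) {(p : ℕ) + 1} = signedPerm (Equiv.swap p (Fin.last n)) (initSign n) := by
  rw [cElt, cyc_singleton hp]
  congr 1
  funext j
  simp [initSign, Fin.ext_iff]

/-- Conjugation flips exactly the signs at the last index and at its preimage `p`. -/
theorem dElt_singleton {p : Fin (n + 1)} (hp : p ≠ Fin.last n) :
    dElt (n + 1) {(p : ℕ) + 1} =
      diagramConj (signedPerm (Equiv.swap p (Fin.last n)) (initSign n)) := by
  rw [dElt, cyc_singleton hp, diagramConj_signedPerm]
  congr 1
  funext j
  by_cases hj : j = Fin.last n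
  · subst hj
    have h : ¬ n = (p : ℕ) := fun h => hp (Fin.ext h.symm)
    rw [Equiv.swap_apply_right, diagramSign_of_ne hp, initSign_last, diagramSign_last]
    simp [h]
  · rw [initSign_of_ne hj, diagramSign_of_ne hj]
    by_cases hjp : j = p
    · subst hjp
      rw [Equiv.swap_apply_left, diagramSign_last]
      simp
    · rw [Equiv.swap_apply_of_ne_of_ne hjp hj, diagramSign_of_ne hj]
      have h : ¬ (j : ℕ) = p := fun h => hjp (Fin.ext h)
      simp [h]

theorem card_nonInversions_le_of_rational (hn : Even n) {u : V (n + 1) ≃ₗ[ℝ] V (n + 1)}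
    (hu : u ∈ rationalElements (n + 1)) : (nonInversions u).card ≤ 2 * n - 1 := by
  have key : ∀ σ : Equiv.Perm (Fin (n + 1)), (∀ i, i ≠ Fin.last n → i ≤ σ i) →
      (nonInversions (signedPerm σ (initSign n))).card ≤ 2 * n - 1 := by
    intro σ hσ
    have h1 := card_nonInversions_le hσ
    have h2 := card_innerFixed_le (σ := σ)
    omega
  obtain ⟨σ, hσ, rfl | rfl⟩ := exists_of_rational hn hu
  · exact key σ hσ
  · rw [card_nonInversions_diagramConj]
    exact key σ hσ

theorem eq_w0_of_card_nonInversions_eq_zero (hn : Even n) {u : V (n + 1) ≃ₗ[ℝ] V (n + 1)}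
    (hu : u ∈ rationalElements (n + 1)) (h : (nonInversions u).card = 0) : u = w0 (n + 1) := by
  have key : ∀ σ : Equiv.Perm (Fin (n + 1)), (∀ i, i ≠ Fin.last n → i ≤ σ i) →
      (nonInversions (signedPerm σ (initSign n))).card = 0 →
      signedPerm σ (initSign n) = w0 (n + 1) := by
    intro σ hσ h0
    have h1 := le_card_nonInversions hσ
    have h2 := (σ (Fin.last n)).is_lt
    have h3 : σ (Fin.last n) = Fin.last n := Fin.ext (by rw [Fin.val_last]; omega)
    rw [w0_eq, eq_swap_of_fixed hσ (fun j hj hj' => absurd (h3 ▸ hj) hj'.asymm), h3]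
  obtain ⟨σ, hσ, rfl | rfl⟩ := exists_of_rational hn hu
  · exact key σ hσ h
  · rw [card_nonInversions_diagramConj] at h
    rw [key σ hσ h, diagramConj_w0]

theorem eq_of_card_nonInversions_eq (hn : Even n) {u : V (n + 1) ≃ₗ[ℝ] V (n + 1)}
    (hu : u ∈ rationalElements (n + 1)) {p : Fin (n + 1)} (hp : p ≠ Fin.last n)
    (hσ : ∀ σ : Equiv.Perm (Fin (n + 1)), (∀ i, i ≠ Fin.last n → i ≤ σ i) →
      (nonInversions (signedPerm σ (initSign n))).card = (nonInversions u).card →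
      σ = Equiv.swap p (Fin.last n)) :
    u = cElt (n + 1) {(p : ℕ) + 1} ∨ u = dElt (n + 1) {(p : ℕ) + 1} := by
  rw [cElt_singleton hp, dElt_singleton hp]
  obtain ⟨σ, h, rfl | rfl⟩ := exists_of_rational hn hu
  · exact Or.inl (by rw [hσ σ h rfl])
  · exact Or.inr (by rw [hσ σ h (card_nonInversions_diagramConj _).symm])

theorem eq_of_card_nonInversions_eq_one (hn : Even n) {u : V (n + 1) ≃ₗ[ℝ] V (n + 1)}
    (hu : u ∈ rationalElements (n + 1)) (h : (nonInversions u).card = 1)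
    {p : Fin (n + 1)} (hp : (p : ℕ) + 1 = n) :
    u = cElt (n + 1) {(p : ℕ) + 1} ∨ u = dElt (n + 1) {(p : ℕ) + 1} := by
  have hpl : p ≠ Fin.last n := by
    rintro rfl
    simp at hp
  refine eq_of_card_nonInversions_eq hn hu hpl fun σ hσ hcard => ?_
  have h1 := le_card_nonInversions hσ
  have h2 := card_nonInversions_le hσ
  have h3 := card_innerFixed_le (σ := σ)
  have h4 := (σ (Fin.last n)).is_lt
  -- The lower bound gives `n - σ (Fin.last n) ≤ 1`, and the upper bound excludes `0`; no inner
  -- index then remains.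
  have h5 : σ (Fin.last n) = p := Fin.ext (by omega)
  rw [eq_swap_of_fixed hσ, h5]
  intro j hj hj'
  rw [h5] at hj
  rw [Fin.lt_def] at hj hj'
  rw [Fin.val_last] at hj'
  omega

theorem eq_of_card_nonInversions_eq_max (hn : Even n) (hn0 : 0 < n)
    {u : V (n + 1) ≃ₗ[ℝ] V (n + 1)} (hu : u ∈ rationalElements (n + 1))
    (h : (nonInversions u).card = 2 * n - 1) :
    u = cElt (n + 1) {((0 : Fin (n + 1)) : ℕ) + 1} ∨
      u = dElt (n + 1) {((0 : Fin (n + 1)) : ℕ) + 1} := by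
  have hpl : (0 : Fin (n + 1)) ≠ Fin.last n := by
    rw [Ne, Fin.ext_iff, Fin.val_last, Fin.val_zero]
    omega
  refine eq_of_card_nonInversions_eq hn hu hpl fun σ hσ hcard => ?_
  have h2 := card_nonInversions_le hσ
  have h3 := card_innerFixed_le (σ := σ)
  -- Equality in `2 (n - p) - 1 ≤ 2 n - 1` forces `p = 0`, and all inner indices must then be fixed.
  have h5 : σ (Fin.last n) = 0 := Fin.ext (by rw [Fin.val_zero]; omega)
  rw [eq_swap_of_fixed hσ, h5]
  intro j hj hj'
  have hcard' : (Finset.Ioo (σ (Fin.last n)) (Fin.last n)).card ≤ (innerFixed σ).card := by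
    rw [Fin.card_Ioo, Fin.val_last]
    omega
  have hmem : j ∈ innerFixed σ := by
    rw [innerFixed, Finset.eq_of_subset_of_card_le (Finset.filter_subset _ _) hcard']
    exact Finset.mem_Ioo.mpr ⟨hj, hj'⟩
  exact (Finset.mem_filter.mp hmem).2

theorem cElt_singleton_mem (hn : Even n) {p : Fin (n + 1)} (hp : p ≠ Fin.last n) :
    cElt (n + 1) {(p : ℕ) + 1} ∈ rationalElements (n + 1) := by
  rw [cElt_singleton hp]
  exact swap_mem_rationalElements hn p

theorem dElt_singleton_mem (hn : Even n) {p : Fin (n + 1)} (hp : p ≠ Fin.last n) :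
    dElt (n + 1) {(p : ℕ) + 1} ∈ rationalElements (n + 1) := by
  rw [dElt_singleton hp]
  exact diagramConj_mem_rationalElements (swap_mem_rationalElements hn p)

theorem length_cElt_singleton (hn : Even n) {p : Fin (n + 1)} (hp : p ≠ Fin.last n) :
    length (cElt (n + 1) {(p : ℕ) + 1}) = (n + 1) * n - ((n - (p : ℕ)) + (n - (p : ℕ) - 1)) := by
  have h := length_add_card_nonInversions (cElt_singleton_mem hn hp).1
  rw [cElt_singleton hp, card_nonInversions_swap] at h
  rw [cElt_singleton hp]
  omega

theorem length_dElt_singleton (hn : Even n) {p : Fin (n + 1)} (hp : p ≠ Fin.last n) :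
    length (dElt (n + 1) {(p : ℕ) + 1}) = (n + 1) * n - ((n - (p : ℕ)) + (n - (p : ℕ) - 1)) := by
  have h := length_add_card_nonInversions (dElt_singleton_mem hn hp).1
  rw [dElt_singleton hp, card_nonInversions_diagramConj, card_nonInversions_swap] at h
  rw [dElt_singleton hp]
  omega

theorem w0_mem_rationalElements (hn : Even n) : w0 (n + 1) ∈ rationalElements (n + 1) := by
  rw [w0_eq]
  exact swap_mem_rationalElements hn _

theorem length_w0 (hn : Even n) : length (w0 (n + 1)) = (n + 1) * n := by
  have h := length_add_card_nonInversions (w0_mem_rationalElements hn).1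
  rw [w0_eq, card_nonInversions_swap, Fin.val_last] at h
  rw [w0_eq]
  omega

end Lengths

end OddTypeD

/-! ### The extreme lengths of rational elements -/

theorem corollary10p2 (r : ℕ) (hr : 5 ≤ r) (hodd : Odd r) :
    {u | u ∈ OddTypeD.rationalElements r ∧ OddTypeD.length u = r * (r - 1)} =
      {OddTypeD.w0 r} ∧
    {u | u ∈ OddTypeD.rationalElements r ∧ OddTypeD.length u = r * (r - 1) - 1} =
      {OddTypeD.cElt r {r - 1}, OddTypeD.dElt r {r - 1}} ∧
    {u | u ∈ OddTypeD.rationalElements r ∧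
        ∀ v ∈ OddTypeD.rationalElements r, OddTypeD.length u ≤ OddTypeD.length v} =
      {OddTypeD.cElt r {1}, OddTypeD.dElt r {1}} ∧
    OddTypeD.length (OddTypeD.cElt r {1}) = r * (r - 1) - (2 * r - 3) ∧
    OddTypeD.length (OddTypeD.dElt r {1}) = r * (r - 1) - (2 * r - 3) := by
  obtain ⟨n, rfl⟩ : ∃ n, r = n + 1 := ⟨r - 1, by omega⟩
  have hn : Even n := by
    rcases Nat.even_or_odd n with h | h
    · exact h
    · exact absurd h.add_one (Nat.not_even_iff_odd.mpr hodd)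
  -- Keeps the natural-number subtractions from `N` from truncating.
  have hN : 2 * n ≤ (n + 1) * n := Nat.mul_le_mul_right n (by omega)
  have hlen := fun {u} (hu : u ∈ OddTypeD.rationalElements (n + 1)) =>
    OddTypeD.length_add_card_nonInversions hu.1
  have hmax := fun {u} (hu : u ∈ OddTypeD.rationalElements (n + 1)) =>
    OddTypeD.card_nonInversions_le_of_rational hn hu
  have h0 : (0 : Fin (n + 1)) ≠ Fin.last n := by
    rw [Ne, Fin.ext_iff, Fin.val_last, Fin.val_zero]
    omega
  let q : Fin (n + 1) := ⟨n - 1, by omega⟩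
  have hqn : (q : ℕ) + 1 = n := show n - 1 + 1 = n by omega
  have hq : q ≠ Fin.last n := by
    rw [Ne, Fin.ext_iff, Fin.val_last]
    omega
  have hc0 := OddTypeD.cElt_singleton_mem hn h0
  have hd0 := OddTypeD.dElt_singleton_mem hn h0
  have hlc0 := OddTypeD.length_cElt_singleton hn h0
  have hld0 := OddTypeD.length_dElt_singleton hn h0
  have hcq := OddTypeD.cElt_singleton_mem hn hq
  have hdq := OddTypeD.dElt_singleton_mem hn hq
  have hlcq := OddTypeD.length_cElt_singleton hn hq
  have hldq := OddTypeD.length_dElt_singleton hn hq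
  have hone := fun {u} (hu : u ∈ OddTypeD.rationalElements (n + 1)) h =>
    OddTypeD.eq_of_card_nonInversions_eq_one hn hu h hqn
  have hext := fun {u} (hu : u ∈ OddTypeD.rationalElements (n + 1)) h =>
    OddTypeD.eq_of_card_nonInversions_eq_max hn (by omega) hu h
  rw [hqn] at hcq hdq hlcq hldq
  simp only [hqn] at hone
  simp only [Fin.val_zero, zero_add] at hc0 hd0 hlc0 hld0 hext
  simp only [Nat.add_sub_cancel]
  refine ⟨?_, ?_, ?_, by omega, by omega⟩
  · ext u
    simp only [Set.mem_ofPred_eq, Set.mem_singleton_iff]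
    constructor
    · rintro ⟨hu, hl⟩
      have := hlen hu
      exact OddTypeD.eq_w0_of_card_nonInversions_eq_zero hn hu (by omega)
    · rintro rfl
      exact ⟨OddTypeD.w0_mem_rationalElements hn, OddTypeD.length_w0 hn⟩
  · ext u
    simp only [Set.mem_ofPred_eq, Set.mem_insert_iff, Set.mem_singleton_iff]
    constructor
    · rintro ⟨hu, hl⟩
      have := hlen hu
      exact hone hu (by omega)
    · rintro (rfl | rfl)
      · exact ⟨hcq, by omega⟩
      · exact ⟨hdq, by omega⟩
  · ext u
    simp only [Set.mem_ofPred_eq, Set.mem_insert_iff, Set.mem_singleton_iff]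
    constructor
    · rintro ⟨hu, hl⟩
      have h1 := hlen hu
      -- Comparison with the known rational element of length `N - (2 n - 1)` makes the count at
      -- least `2 n - 1`, hence maximal.
      have h2 := hl _ hc0
      have h3 := hmax hu
      exact hext hu (by omega)
    · rintro (rfl | rfl)
      · refine ⟨hc0, fun v hv => ?_⟩
        have h1 := hlen hv
        have h2 := hmax hv
        omega
      · refine ⟨hd0, fun v hv => ?_⟩
        have h1 := hlen hv
        have h2 := hmax hv
        omega
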